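/- Let $q=p^e$ with $p$ prime, let $0\le k<e$, and let $t_1,\dots,t_\ell\in\mathbb F_q[X]$ be square-free polynomials that split into linear factors over $\mathbb F_q$. Let $\mathcal A=\mathbb F_q[X_1,\dots,X_\ell]/\langle t_1(X_1),\dots,t_\ell(X_\ell)\rangle$, let $H=\prod_i H_i$, where $H_i$ is the set of roots of $t_i$, let $\hat S$ be the set of the classes $S(\nu)=\{(\nu_1^{q^m},\dots,\nu_\ell^{q^m}):m\in\mathbb N\}$, $\nu\in H$, and let $e_S$ $(S\in\hat S)$ be the primitive idempotent of $\mathcal A$ that takes the value $1$ on $S$ and $0$ on $H\setminus S$, so that $\mathcal A=\bigoplus_{S\in\hat S}\mathbb F_q e_S$. A linear code $C\subseteq\mathcal A^n$ (an $\mathcal A$-submodule) is $\lambda$-constacyclic if it corresponds to an ideal of $\mathcal A[x]/\langle x^n-\lambda\rangle$ under $c\mapsto\sum_i c_ix^i$. Its component $C_S\subseteq\mathbb F_q^n$ is $\{(\rho_{0,S},\dots,\rho_{n-1,S}):\rho\in C\}$, where $\rho_i=\sum_S\rho_{i,S}e_S$ with $\rho_{i,S}\in\mathbb F_q$. The $k$-Galois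 hull of $C$ is $\mathrm{hull}_k(C)=C\cap C^{\perp_k}$, where $C^{\perp_k}=\{a\in\mathcal A^n:\sum_i a_ic_i^{p^k}=0\text{ for all }c\in C\}$. For a polynomial $f=\sum_{i=0}^d f_ix^i$ of degree $d$ over $\mathbb F_q$ with $f_0\ne0$ put $f^{\#}=\sum_{i=0}^d f_0^{-p^{e-k}}f_i^{p^{e-k}}x^{d-i}$, and let $f^{\delta\#}$ be its $\delta$-fold iterate. Let $n=n'p^{e'}\geq 1$ with $\gcd(n',p)=1$ and $e'\ge 0$, and let $\lambda$ be a unit of $\mathcal A$ with $\gcd(\mathrm{ord}(\lambda),n')=1$ and $\mathrm{ord}(\lambda)\mid 1+p^{e-k}$. Write $\lambda=\sum_S\lambda_Se_S$ with $\lambda_S\in\mathbb F_q$, and let $r_S=\mathrm{ord}(\lambda_S)$. Let $l'$ be the least positive multiple of $\mathrm{lcm}(e,e-k)$ such that $l=l'/(e-k)$ is even, and let $a_1=1,a_2,\dots,a_s$ be the distinct positive divisors of $l$. Let $$\mathcal A_S=\{j\in\mathbb N:\gcd(j,q)=1,\ j\mid n'r_S,\ \gcd(n'r_S/j,r_S)=1\},$$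 let $B_i$ be the set of all $j\in\mathbb N$ such that $i$ is the least positive integer with $j\mid p^{em}+(-1)^{i-1}p^{i(e-k)}$ for at least one integer $m\ge0$, and let $D_{St}=\mathcal A_S\cap B_{a_t}$ and $\beta_{St}(j)=\dfrac{\phi(j)}{a_t\,\phi(r_S)\,\mathrm{ord}_j(q)}$, where $\mathrm{ord}_j(q)$ is the multiplicative order of $q$ modulo $j$. Then for each $S\in\hat S$ there is a factorization $$x^n-\lambda_S=\prod_{t=1}^s\prod_{j\in D_{St}}\prod_{i=1}^{\beta_{St}(j)}\bigl\{f_{ij}f_{ij}^{\#}\cdots f_{ij}^{(a_t-1)\#}\bigr\}^{p^{e'}}\qquad(*)$$ over $\mathbb F_q$ in which each $f_{ij}$ (depending on $S$) is a monic irreducible factor of the $j$-th cyclotomic polynomial. Fix any such factorizations. For every $\lambda$-constacyclic code $C$ of length $n$ over $\mathcal A$ there are integers $0\le u_{Stij,\delta}\le p^{e'}$ such that, for each $S\in\hat S$, the monic generator polynomial (dividing $x^n-\lambda_S$) of the $\lambda_S$-constacyclic code $C_S$ is $$g_S=\prod_{t=1}^s\prod_{j\in D_{St}}\prod_{i=1}^{\beta_{St}(j)}\prod_{\delta=0}^{a_t-1}\bigl(f_{ij}^{\delta\#}\bigr)^{u_{Stij,\delta}},$$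 and $$\dim_{\mathbb F_q}\mathrm{hull}_k(C)=\sum_{S\in\hat S}\sum_{t=1}^s\sum_{j\in D_{St}}\mathrm{ord}_j(q)\cdot b_{Stj},\qquad b_{Stj}=\sum_{i=1}^{\beta_{St}(j)}b_{Stij},$$ $$b_{Stij}=a_tp^{e'}-\sum_{\delta=0}^{a_t-1}\max\{u_{Stij,\delta},\;p^{e'}-u_{Stij,\delta-1}\},$$ where the index $\delta-1$ is read modulo $a_t$. Moreover, $0\le b_{Stj}\le\beta_{St}(j)\cdot\lfloor a_tp^{e'}/2\rfloor$ for all $S\in\hat S$, $1\le t\le s$ and $j\in D_{St}$. -/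

import Mathlib

namespace GaloisHull

noncomputable section

open Polynomial

/-! ### The alphabet `𝒜 = 𝔽_q[X₁,…,X_ℓ]/⟨t₁(X₁),…,t_ℓ(X_ℓ)⟩` and its idempotents -/

section Alphabet

variable {F : Type*} [Field F] {l : ℕ}

/-- The ideal `⟨t₁(X₁), …, t_ℓ(X_ℓ)⟩`. -/
def relationIdeal (t : Fin l → F[X]) : Ideal (MvPolynomial (Fin l) F) :=
  Ideal.span (Set.range fun i => aeval (MvPolynomial.X i) (t i))

/-- The commutative affine algebra `𝒜`. -/
abbrev Alphabet (t : Fin l → F[X]) : Type _ :=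
  MvPolynomial (Fin l) F ⧸ relationIdeal t

open Classical in
/-- `H_i`: the set of roots of `t_i` (used for `t_i` that split over `F`). -/
def rootFinset (t : Fin l → F[X]) (i : Fin l) : Finset F := (t i).roots.toFinset

/-- `H = ∏ H_i`. -/
def rootTuples (t : Fin l → F[X]) : Finset (Fin l → F) :=
  Fintype.piFinset (rootFinset t)

variable [Fintype F]

open Classical in
/-- The class `S(ν) = {(ν₁^{q^m}, …, ν_ℓ^{q^m}) : m ∈ ℕ}`. -/
def conjClass (t : Fin l → F[X]) (ν : Fin l → F) : Finset (Fin l → F) :=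
  (rootTuples t).filter fun μ => ∃ m : ℕ, μ = fun i => ν i ^ (Fintype.card F) ^ m

open Classical in
/-- `Ŝ`: the set of all the classes `S(ν)`, `ν ∈ H`. -/
def classes (t : Fin l → F[X]) : Finset (Finset (Fin l → F)) :=
  (rootTuples t).image (conjClass t)

open Classical in
/-- The primitive idempotent `e_S` of `𝒜`: the residue class of the interpolation polynomial that is
`1` at the points of `S` and `0` at the other points of `H`. -/
def classIdem (t : Fin l → F[X]) (S : classes t) : Alphabet t :=
  Ideal.Quotient.mk (relationIdeal t)
    (∑ ν ∈ (S : Finset (Fin l → F)), ∏ i,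
      aeval (MvPolynomial.X i) (Lagrange.basis (rootFinset t i) id (ν i)))

/-- `C_S ⊆ 𝔽_q^n`: all vectors `(ρ_{0,S}, …, ρ_{n-1,S})` where `ρ ∈ C` and
`ρ_i = ∑_S ρ_{i,S} e_S` with `ρ_{i,S} ∈ 𝔽_q`. -/
def projCode {n : ℕ} (t : Fin l → F[X]) (C : Submodule (Alphabet t) (Fin n → Alphabet t))
    (S : classes t) : Set (Fin n → F) :=
  {v | ∃ ρ ∈ C, ∃ c : classes t → Fin n → F,
    (∀ i, ρ i = ∑ T, c T i • classIdem t T) ∧ v = c S}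

end Alphabet

/-! ### Codes over a commutative ring -/

section Codes

variable {R : Type*} [CommRing R] {n : ℕ}

/-- The polynomial `c₀ + c₁ x + ⋯ + c_{n-1} x^{n-1}` of a word. -/
def wordPoly (c : Fin n → R) : R[X] := ∑ i, C (c i) * X ^ (i : ℕ)

/-- `R[x]/⟨x^n - lam⟩`. -/
abbrev ConstaRing (n : ℕ) (lam : R) : Type _ :=
  R[X] ⧸ Ideal.span {(X ^ n - C lam : R[X])}

/-- The class of the polynomial of a word in `R[x]/⟨x^n - lam⟩`. -/
def wordClass (lam : R) (c : Fin n → R) : ConstaRing n lam :=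
  Ideal.Quotient.mk (Ideal.span {(X ^ n - C lam : R[X])}) (wordPoly c)

/-- A linear code is `lam`-constacyclic if it is identified with an ideal of `R[x]/⟨x^n - lam⟩`. -/
def IsConstacyclic (lam : R) (D : Submodule R (Fin n → R)) : Prop :=
  ∃ J : Ideal (ConstaRing n lam), ∀ c : Fin n → R, c ∈ D ↔ wordClass lam c ∈ J

/-- `g` is the generator polynomial of the `lam`-constacyclic code `D`: the monic divisor of
`x^n - lam` that generates the corresponding ideal of `R[x]/⟨x^n - lam⟩`. -/
def IsGeneratorPoly (lam : R) (D : Set (Fin n → R)) (g : R[X]) : Prop :=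
  g.Monic ∧ g ∣ X ^ n - C lam ∧
    ∀ c : Fin n → R, c ∈ D ↔ wordClass lam c ∈
      Ideal.span {Ideal.Quotient.mk (Ideal.span {(X ^ n - C lam : R[X])}) g}

/-- The `k`-Galois inner product `⟨a, b⟩_k = ∑ a_i b_i^{p^k}`. -/
def galoisInner (p k : ℕ) (a b : Fin n → R) : R := ∑ i, a i * b i ^ p ^ k

/-- The `k`-Galois dual `{a | ⟨a, c⟩_k = 0 for all c ∈ D}`. -/
def galoisDual (p k : ℕ) (D : Submodule R (Fin n → R)) : Submodule R (Fin n → R) where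
  carrier := {a | ∀ c ∈ D, galoisInner p k a c = 0}
  zero_mem' := by intro c _; simp [galoisInner]
  add_mem' := by
    intro a b ha hb c hc
    have h1 := ha c hc
    have h2 := hb c hc
    simp only [galoisInner] at h1 h2 ⊢
    simp only [Pi.add_apply, add_mul, Finset.sum_add_distrib, h1, h2, add_zero]
  smul_mem' := by
    intro x a ha c hc
    have h1 := ha c hc
    simp only [galoisInner] at h1 ⊢
    simp only [Pi.smul_apply, smul_eq_mul, mul_assoc, ← Finset.mul_sum, h1, mul_zero]

/-- The `k`-Galois hull `D ∩ D^{⊥_k}`. -/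
def galoisHull (p k : ℕ) (D : Submodule R (Fin n → R)) : Submodule R (Fin n → R) :=
  D ⊓ galoisDual p k D

end Codes

/-! ### The operation `#` and the combinatorial data of the factorization -/

/-- `ord_j(q)`, the multiplicative order of `q` modulo `j`. -/
def ordMod (j q : ℕ) : ℕ := orderOf (q : ZMod j)

/-- `l = l'/(e-k)`, where `l'` is the least positive multiple of `lcm(e, e-k)` such that
`l'/(e-k)` is even. -/
def hashPeriod (e k : ℕ) : ℕ :=
  sInf {m : ℕ | 0 < m ∧ Nat.lcm e (e - k) ∣ m ∧ Even (m / (e - k))} / (e - k)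

/-- The set of all `j` with `gcd(j,q) = 1`, `j ∣ n'r` and `gcd(n'r/j, r) = 1`. -/
def setA (q n' r : ℕ) : Finset ℕ :=
  (n' * r).divisors.filter fun j => Nat.Coprime j q ∧ Nat.Coprime (n' * r / j) r

/-- `B_i`: the set of all `j` such that `i` is the least positive integer for which
`j ∣ p^{e m} + (-1)^{i-1} p^{i(e-k)}` for at least one `m ∈ ℕ`. -/
def setB (p e k i : ℕ) : Set ℕ :=
  {j | IsLeast {i' : ℕ | 0 < i' ∧
    ∃ m : ℕ, (j : ℤ) ∣ (p : ℤ) ^ (e * m) + (-1) ^ (i' - 1) * (p : ℤ) ^ (i' * (e - k))} i}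

open Classical in
/-- `D_a = A ∩ B_a`, for a divisor `a` of `l`. -/
def setD (p e k n' r a : ℕ) : Finset ℕ :=
  (setA (p ^ e) n' r).filter fun j => j ∈ setB p e k a

/-- `β_a(j) = φ(j) / (a φ(r) ord_j(q))`. -/
def betaCount (q r a j : ℕ) : ℕ := j.totient / (a * r.totient * ordMod j q)

/-- `b = aP - ∑_{δ < a} max {u_δ, P - u_{δ-1}}`, the index `δ - 1` being read modulo `a`. -/
def bTerm (P a : ℕ) (u : ℕ → ℕ) : ℤ :=
  (a : ℤ) * P - ∑ δ ∈ Finset.range a, max (u δ : ℤ) ((P : ℤ) - u ((δ + a - 1) % a))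

section Hash

variable {F : Type*} [Field F]

/-- `f^# = ∑ f₀^{-p^{e-k}} f_i^{p^{e-k}} x^{deg f - i}`. -/
def hash (p e k : ℕ) (f : F[X]) : F[X] :=
  ∑ i ∈ Finset.range (f.natDegree + 1),
    C ((f.coeff 0 ^ p ^ (e - k))⁻¹ * f.coeff i ^ p ^ (e - k)) * X ^ (f.natDegree - i)

/-- The product `∏_a ∏_{j ∈ D_a} ∏_{i < β_a(j)} ∏_{δ < a} (f_{ij}^{δ#})^{u_{aij,δ}}`, where `a` runs
through the positive divisors of `l`. -/
def hashProd (p e k n' r : ℕ) (f : ℕ → ℕ → F[X]) (u : ℕ → ℕ → ℕ → ℕ → ℕ) : F[X] :=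
  ∏ a ∈ (hashPeriod e k).divisors, ∏ j ∈ setD p e k n' r a,
    ∏ i ∈ Finset.range (betaCount (p ^ e) r a j),
      ∏ δ ∈ Finset.range a, ((hash p e k)^[δ] (f j i)) ^ u a j i δ

/-- The polynomials `f j i` realize the `#`-orbit factorization
`x^n - lam = ∏_a ∏_{j ∈ D_a} ∏_{i < β_a(j)} {f_{ij} f_{ij}^# ⋯ f_{ij}^{(a-1)#}}^{p^{e'}}`, where
`n = n' p^{e'}` and each `f_{ij}` is a monic irreducible factor of the `j`-th cyclotomic polynomial
(that is, it is monic and irreducible and its roots have multiplicative order `j`). -/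
def IsHashFactorization (p e k n' e' : ℕ) (lam : F) (f : ℕ → ℕ → F[X]) : Prop :=
  (∀ a ∈ (hashPeriod e k).divisors, ∀ j ∈ setD p e k n' (orderOf lam) a,
    ∀ i < betaCount (p ^ e) (orderOf lam) a j,
      (f j i).Monic ∧ Irreducible (f j i) ∧ f j i ∣ cyclotomic j F) ∧
  X ^ (n' * p ^ e') - C lam =
    hashProd p e k n' (orderOf lam) f fun _ _ _ _ => p ^ e'

end Hash

end

end GaloisHull

open GaloisHull

/-! All points of `H` have coordinates in `F`, so the `q`-power map fixes them and every class is a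
single point. By Lagrange interpolation the `t_i`, having simple roots in `F`, make evaluation at
the points of `H` an isomorphism of `𝒜` with a product of copies of `F` (`eq_sum_classEval`). Codes,
Galois duals and hulls split accordingly (`mem_galoisHull_iff_forall_component`), so the dimension
of the hull is a sum over classes (`finrank_galoisHull`) and the question is one over `F`.

Over `F`, let `g` generate the code and let `h` be its cofactor in `x^n - λ`. The `(e-k)`-th
Frobenius power turns `∑ a_i c_i^{p^k}` into `∑ a_i^{p^{e-k}} c_i`, which is the coefficient of
`x^{n-1}` in a product of polynomials. Hence `a` is in the dual iff `h` divides the reversal of the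
Frobenius twist of `a`. If `h = G^#`, this says `G ∣ a` (`mem_galoisHull_iff`): the hull consists of
the common multiples of `g` and `G`.

To find `G`, follow the roots: `#` sends a root `α` to `α^{-p^{e-k}}`. Write `λ = b^n` with `b` in
`F` of the same order `r`, and `x^n - λ = (x^{n'} - b^{n'})^{p^{e'}}`, with roots `bζ`, `ζ^{n'} =
1`. Since `r ∣ 1 + p^{e-k}`, `b^{-p^{e-k}} = b`, so `#` permutes the minimal polynomials of the `bζ`
with `ζ` of given order `d`. The orbit length of such a polynomial depends only on the order `j =
rd` of its roots (`mem_setB_iff_eq_minimalPeriod`), and counting gives `β_a(j)` orbits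
(`exists_representatives`).

Writing `P = p^{e'}`, if `g` has exponents `u_δ` along an orbit, `h` has `P - u_δ`; as `#` shifts
the orbit, `G` has `P - u_{δ+1}`. The exponents of the lcm are `max(u_δ, P - u_{δ+1})`, and the
dimension is `n` minus its degree. A telescoping cyclic sum converts this into the formula with
`u_{δ-1}` (`bTerm_eq_sum`). -/

namespace GaloisHull

open Polynomial

/-! ### The operation `#` on polynomials -/

section HashAlgebra

variable {F : Type*} [Field F] {p : ℕ} [ExpChar F p] {e k : ℕ}

/-- Splits `#` into Frobenius on coefficients, reversal and a scalar; each is multiplicative, hence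
so is `#`. -/
theorem hash_eq_reverse (f : F[X]) :
    hash p e k f = C ((f.coeff 0 ^ p ^ (e - k))⁻¹) *
      (f.map (iterateFrobenius F p (e - k))).reverse := by
  have h : f.map (iterateFrobenius F p (e - k)) = ∑ i ∈ Finset.range (f.natDegree + 1),
      C (f.coeff i ^ p ^ (e - k)) * X ^ i := by
    conv_lhs => rw [f.as_sum_range_C_mul_X_pow]
    simp [Polynomial.map_sum, iterateFrobenius_def]
  have hs : ∀ s : Finset ℕ, ∀ N : ℕ, ∀ b : ℕ → F[X],
      reflect N (∑ i ∈ s, b i) = ∑ i ∈ s, reflect N (b i) := by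
    intro s N b
    induction s using Finset.cons_induction with
    | empty => simp
    | cons i s hi ih => rw [Finset.sum_cons, Finset.sum_cons, reflect_add, ih]
  rw [reverse, natDegree_map, h, hs, hash, Finset.mul_sum]
  refine Finset.sum_congr rfl fun i hi => ?_
  rw [reflect_C_mul_X_pow, revAt_le (by simpa [Nat.lt_succ_iff] using hi), ← mul_assoc, ← C_mul]

theorem hash_mul (f g : F[X]) : hash p e k (f * g) = hash p e k f * hash p e k g := by
  simp only [hash_eq_reverse, Polynomial.map_mul, reverse_mul_of_domain, mul_coeff_zero, mul_pow,
    mul_inv, C_mul]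
  ring

theorem hash_one : hash p e k (1 : F[X]) = 1 := by
  have h : (1 : F[X]).reverse = 1 := by simpa using reverse_C (1 : F)
  simp [hash_eq_reverse, h]

/-- `hash` as a monoid homomorphism. -/
noncomputable def hashHom (F : Type*) [Field F] (p : ℕ) [ExpChar F p] (e k : ℕ) : F[X] →* F[X] where
  toFun := hash p e k
  map_one' := hash_one
  map_mul' := hash_mul

theorem hashHom_apply (f : F[X]) : hashHom F p e k f = hash p e k f := rfl

theorem natDegree_hash {f : F[X]} (h0 : f.coeff 0 ≠ 0) :
    (hash p e k f).natDegree = f.natDegree := by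
  have hp : (f.coeff 0 ^ p ^ (e - k))⁻¹ ≠ 0 := inv_ne_zero (pow_ne_zero _ h0)
  rw [hash_eq_reverse, natDegree_C_mul hp, reverse_natDegree,
    natDegree_map, natTrailingDegree_eq_zero.2 (Or.inr _), Nat.sub_zero]
  simpa [iterateFrobenius_def] using fun h => absurd h h0

theorem monic_hash {f : F[X]} (h0 : f.coeff 0 ≠ 0) : (hash p e k f).Monic := by
  have hp : f.coeff 0 ^ p ^ (e - k) ≠ 0 := pow_ne_zero _ h0
  have hc : (f.map (iterateFrobenius F p (e - k))).coeff 0 ≠ 0 := by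
    simpa [iterateFrobenius_def] using fun h => absurd h h0
  rw [Monic, hash_eq_reverse, leadingCoeff_mul, leadingCoeff_C, reverse_leadingCoeff,
    trailingCoeff_eq_coeff_zero hc, coeff_map, iterateFrobenius_def, inv_mul_cancel₀ hp]

/-- Up to a unit, `#` reverses the twisted polynomial, and reflection carries divisors of a nonzero
polynomial to divisors. Reflecting twice is the identity, and `f.coeff 0 ≠ 0` keeps the degree of
`f` under reversal, so the argument also runs backwards. -/
theorem hash_dvd_reflect_map {f a : F[X]} {N : ℕ} (h0 : f.coeff 0 ≠ 0) (ha : a.natDegree ≤ N) :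
    hash p e k f ∣ reflect N (a.map (iterateFrobenius F p (e - k))) ↔ f ∣ a := by
  set φ := iterateFrobenius F p (e - k)
  have hc : IsUnit (C ((f.coeff 0 ^ p ^ (e - k))⁻¹)) :=
    isUnit_C.2 (inv_ne_zero (pow_ne_zero _ h0)).isUnit
  have key : ∀ g b : F[X], g.natDegree ≤ N → g ∣ b → b.natDegree ≤ N →
      reflect g.natDegree g ∣ reflect N b := by
    rintro g b hg ⟨c, rfl⟩ hb
    by_cases hgc : g * c = 0
    · simp [hgc]
    rw [natDegree_mul (left_ne_zero_of_mul hgc) (right_ne_zero_of_mul hgc)] at hb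
    have := reflect_mul g c (F := g.natDegree) (G := N - g.natDegree) le_rfl (by omega)
    rw [Nat.add_sub_cancel' hg] at this
    exact ⟨_, this⟩
  rw [hash_eq_reverse, hc.mul_left_dvd]
  by_cases ha0 : a = 0
  · simp [ha0]
  have hrd : (f.map φ).reverse.natDegree = f.natDegree := by
    rw [reverse_natDegree, natDegree_map, natTrailingDegree_eq_zero.2 (Or.inr _), Nat.sub_zero]
    simpa [φ, iterateFrobenius_def] using fun h => absurd h h0
  constructor
  · intro h
    have hne : reflect N (a.map φ) ≠ 0 := by
      simpa [reflect_eq_zero_iff] using ha0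
    have hle : (reflect N (a.map φ)).natDegree ≤ N := by
      rw [natDegree_le_iff_coeff_eq_zero]
      intro i hi
      rw [coeff_reflect, revAt_eq_self_of_lt hi, coeff_eq_zero_of_natDegree_lt]
      rw [natDegree_map]; omega
    have h1 := key _ _ ((natDegree_le_of_dvd h hne).trans hle) h hle
    rw [reflect_reflect, hrd, reverse, natDegree_map, reflect_reflect] at h1
    exact (map_dvd_map' φ).1 h1
  · intro h
    have h1 := key (f.map φ) (a.map φ) (by rw [natDegree_map]; exact (natDegree_le_of_dvd h ha0).trans ha)
      ((map_dvd_map' φ).2 h) (by rwa [natDegree_map])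
    exact h1

end HashAlgebra

/-! ### Words as polynomials of degree less than `n` -/

section Words

variable {R : Type*} [CommRing R] {n : ℕ}

theorem coeff_wordPoly (c : Fin n → R) (i : Fin n) : (wordPoly c).coeff i = c i := by
  simp [wordPoly, coeff_X_pow, Fin.val_inj]

theorem degree_wordPoly_lt (c : Fin n → R) : (wordPoly c).degree < n := by
  refine (degree_sum_le _ _).trans_lt ((Finset.sup_lt_iff (WithBot.bot_lt_coe n)).2 fun i _ => ?_)
  exact (degree_C_mul_X_pow_le _ _).trans_lt (WithBot.coe_lt_coe.2 i.2)

theorem wordPoly_coeff {Q : R[X]} (hQ : Q.degree < n) :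
    wordPoly (fun i : Fin n => Q.coeff i) = Q := by
  by_cases hn : n = 0
  · subst hn
    have : Q = 0 := by simpa [Nat.WithBot.lt_zero_iff] using hQ
    simp [wordPoly, this]
  rw [wordPoly, Fin.sum_univ_eq_sum_range (fun i => C (Q.coeff i) * X ^ i)]
  by_cases h0 : Q = 0
  · simp [h0]
  exact (Q.as_sum_range_C_mul_X_pow' ((natDegree_lt_iff_degree_lt h0).2 hQ)).symm

theorem wordPoly_add (c d : Fin n → R) : wordPoly (c + d) = wordPoly c + wordPoly d := by
  simp [wordPoly, add_mul, Finset.sum_add_distrib]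

theorem wordPoly_smul (x : R) (c : Fin n → R) : wordPoly (x • c) = C x * wordPoly c := by
  simp [wordPoly, Finset.mul_sum, mul_assoc]

theorem wordPoly_injective : Function.Injective (wordPoly : (Fin n → R) → R[X]) := by
  intro c d h
  ext i
  rw [← coeff_wordPoly c, h, coeff_wordPoly]

theorem map_wordPoly {S : Type*} [CommRing S] (φ : R →+* S) (c : Fin n → R) :
    (wordPoly c).map φ = wordPoly fun i => φ (c i) := by
  simp [wordPoly, Polynomial.map_sum]

theorem coeff_reflect_mul {A B : R[X]} (hn : 0 < n) :
    (reflect (n - 1) A * B).coeff (n - 1) = ∑ i ∈ Finset.range n, A.coeff i * B.coeff i := by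
  rw [coeff_mul, Finset.Nat.sum_antidiagonal_eq_sum_range_succ
    (fun i j => (reflect (n - 1) A).coeff i * B.coeff j), Nat.succ_eq_add_one,
    Nat.sub_add_cancel hn, ← Finset.sum_range_reflect]
  refine Finset.sum_congr rfl fun i hi => ?_
  have := Finset.mem_range.1 hi
  rw [coeff_reflect, revAt_le (by omega)]
  congr 2 <;> omega

end Words

/-! ### Constacyclic codes over a field: dimension, Galois dual and hull -/

section Field

variable {F : Type*} [Field F] {n : ℕ}

/-- Because `g` divides `x^n - lam`, membership in the ideal of the quotient does not depend on the
representative and becomes divisibility in `F[X]`. -/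
theorem isGeneratorPoly_iff {lam : F} {D : Set (Fin n → F)} {g : F[X]} :
    IsGeneratorPoly lam D g ↔
      g.Monic ∧ g ∣ X ^ n - C lam ∧ ∀ c : Fin n → F, c ∈ D ↔ g ∣ wordPoly c := by
  refine and_congr_right fun _ => and_congr_right fun hg => forall_congr' fun c => ?_
  have : wordClass lam c ∈
      Ideal.span {Ideal.Quotient.mk (Ideal.span {(X ^ n - C lam : F[X])}) g} ↔ g ∣ wordPoly c := by
    rw [← Set.image_singleton (f := Ideal.Quotient.mk (Ideal.span {(X ^ n - C lam : F[X])})),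
      ← Ideal.map_span, wordClass, Ideal.mem_map_iff_of_surjective _ Ideal.Quotient.mk_surjective]
    simp only [Ideal.mem_span_singleton, Ideal.Quotient.mk_eq_mk_iff_sub_mem]
    exact ⟨fun ⟨x, hx, h⟩ => (dvd_iff_dvd_of_dvd_sub (hg.trans h)).1 hx, fun h => ⟨_, h, by simp⟩⟩
  rw [this]

/-- The space of words whose polynomial is a multiple of a monic `L` has dimension
`n - deg L`. -/
theorem finrank_eq_sub_natDegree {L : F[X]} (hL : L.Monic) (hLn : L.natDegree ≤ n)
    (D : Submodule F (Fin n → F)) (hD : ∀ c, c ∈ D ↔ L ∣ wordPoly c) :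
    Module.finrank F D = n - L.natDegree := by
  set m := n - L.natDegree
  have hdeg : ∀ b : Fin m → F, (L * wordPoly b).degree < n := by
    intro b
    rw [degree_mul, degree_eq_natDegree hL.ne_zero]
    by_cases hb : wordPoly b = 0
    · simp [hb]
    · have := (natDegree_lt_iff_degree_lt hb).2 (degree_wordPoly_lt b)
      rw [degree_eq_natDegree hb]
      exact_mod_cast (by omega : L.natDegree + (wordPoly b).natDegree < n)
  let f : (Fin m → F) →ₗ[F] (Fin n → F) :=
    { toFun := fun b i => (L * wordPoly b).coeff i
      map_add' := fun b c => by ext i; simp [wordPoly_add, mul_add]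
      map_smul' := fun x b => by
        ext i
        simp [wordPoly_smul, mul_left_comm L, coeff_C_mul] }
  have hf : ∀ b, wordPoly (f b) = L * wordPoly b := fun b => wordPoly_coeff (hdeg b)
  have hinj : Function.Injective f := by
    intro b c h
    have h2 : L * wordPoly b = L * wordPoly c := by rw [← hf, h, hf]
    exact wordPoly_injective (mul_left_cancel₀ hL.ne_zero h2)
  have hr : LinearMap.range f = D := by
    ext c
    rw [hD, LinearMap.mem_range]
    constructor
    · rintro ⟨b, rfl⟩
      exact ⟨_, hf b⟩
    · rintro ⟨B, hB⟩
      have hBdeg : B.degree < (m : ℕ) := by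
        have := degree_wordPoly_lt c
        rw [hB, degree_mul, degree_eq_natDegree hL.ne_zero] at this
        by_cases hb : B = 0
        · simp [hb]
        · rw [degree_eq_natDegree hb] at this ⊢
          have : L.natDegree + B.natDegree < n := by exact_mod_cast this
          exact_mod_cast (by omega : B.natDegree < m)
      refine ⟨fun i => B.coeff i, wordPoly_injective ?_⟩
      rw [hf, wordPoly_coeff hBdeg, hB]
  rw [← hr, LinearMap.finrank_range_of_inj hinj, Module.finrank_fin_fun]

/-- `h = (x^n - lam) / g` divides `A` iff `A` annihilates, under the pairing
`(A, Q) ↦ coeff (A * Q) (n - 1)`, all multiples of `g` of degree less than `n`. -/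
theorem forall_coeff_mul_eq_zero_iff {g h A : F[X]} {lam : F} (hn : 0 < n)
    (hgh : g * h = X ^ n - C lam) (hA : A.degree < n) :
    (∀ Q : F[X], Q.degree < n → g ∣ Q → (A * Q).coeff (n - 1) = 0) ↔ h ∣ A := by
  have hne : g * h ≠ 0 := by rw [hgh]; exact X_pow_sub_C_ne_zero hn lam
  have hg0 := left_ne_zero_of_mul hne
  have hh0 := right_ne_zero_of_mul hne
  have hdeg : g.natDegree + h.natDegree = n := by
    rw [← natDegree_mul hg0 hh0, hgh, natDegree_X_pow_sub_C]
  -- The product is `B T x^n - lam B T` with `deg (B T) ≤ n - 2`, so it has a gap at degree `n - 1`.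
  have key : ∀ A Q : F[X], A.degree < n → Q.degree < n → h ∣ A → g ∣ Q →
      (A * Q).coeff (n - 1) = 0 := by
    rintro A Q hA hQ ⟨B, rfl⟩ ⟨T, rfl⟩
    have h1 : h * B * (g * T) = B * T * X ^ n - C lam * (B * T) := by
      linear_combination B * T * hgh
    by_cases h0 : h * B * (g * T) = 0
    · simp [h0]
    have hA0 := left_ne_zero_of_mul h0
    have hQ0 := right_ne_zero_of_mul h0
    have hB := right_ne_zero_of_mul hA0
    have hT := right_ne_zero_of_mul hQ0
    rw [← natDegree_lt_iff_degree_lt hA0, natDegree_mul hh0 hB] at hA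
    rw [← natDegree_lt_iff_degree_lt hQ0, natDegree_mul hg0 hT] at hQ
    rw [h1, coeff_sub, coeff_mul_X_pow', if_neg (by omega), coeff_C_mul,
      coeff_eq_zero_of_natDegree_lt (n := n - 1) (by rw [natDegree_mul hB hT]; omega)]
    simp
  refine ⟨fun H => ?_, fun hd Q hQ hgQ => key A Q hA hQ hd hgQ⟩
  have hR : A % h = 0 := by
    by_contra hR
    have hRlt : (A % h).natDegree < h.natDegree :=
      (natDegree_lt_natDegree_iff hR).2 (EuclideanDomain.mod_lt A hh0)
    -- This exponent gives `(A % h) * (g * X ^ m)` degree exactly `n - 1`, so the vanishing pairing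
    -- would be its leading coefficient.
    set m := h.natDegree - 1 - (A % h).natDegree with hm
    have hQ0 : g * X ^ m ≠ 0 := mul_ne_zero hg0 (pow_ne_zero _ X_ne_zero)
    have hQdeg : (g * X ^ m).natDegree = g.natDegree + m := by
      rw [natDegree_mul hg0 (pow_ne_zero _ X_ne_zero), natDegree_X_pow]
    have hQ : (g * X ^ m).degree < (n : WithBot ℕ) :=
      (natDegree_lt_iff_degree_lt hQ0).1 (by omega)
    have h1 := H _ hQ (dvd_mul_right _ _)
    have h2 : (h * (A / h) * (g * X ^ m)).coeff (n - 1) = 0 := by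
      refine key _ _ ?_ hQ (dvd_mul_right _ _) (dvd_mul_right _ _)
      have : h * (A / h) = A - A % h := by rw [eq_sub_iff_add_eq, EuclideanDomain.div_add_mod]
      rw [this]
      refine (degree_sub_le _ _).trans_lt (max_lt hA ((natDegree_lt_iff_degree_lt hR).1 (by omega)))
    have h3 : (A % h * (g * X ^ m)).coeff (n - 1) = 0 := by
      have : A % h * (g * X ^ m) = A * (g * X ^ m) - h * (A / h) * (g * X ^ m) := by
        rw [← sub_mul]; congr 1; rw [eq_sub_iff_add_eq', EuclideanDomain.div_add_mod]
      rw [this, coeff_sub, h1, h2, sub_zero]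
    have h4 : n - 1 = (A % h * (g * X ^ m)).natDegree := by
      rw [natDegree_mul hR hQ0, hQdeg]; omega
    rw [h4, coeff_natDegree, leadingCoeff_eq_zero] at h3
    exact mul_ne_zero hR hQ0 h3
  exact EuclideanDomain.mod_eq_zero.1 hR

variable [Fintype F] {p e k : ℕ} [ExpChar F p]

/-- The `(e-k)`-th Frobenius power is injective and turns `c_i^{p^k}` into `c_i^q = c_i`, which
makes the form bilinear in the twisted `a` and `c`. -/
theorem galoisInner_eq_zero_iff (hq : Fintype.card F = p ^ e) (hk : k ≤ e) (hn : 0 < n)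
    (a c : Fin n → F) : galoisInner p k a c = 0 ↔
      (reflect (n - 1) ((wordPoly a).map (iterateFrobenius F p (e - k))) *
        wordPoly c).coeff (n - 1) = 0 := by
  rw [← map_eq_zero_iff (iterateFrobenius F p (e - k)) (RingHom.injective _), galoisInner, map_sum,
    coeff_reflect_mul hn, ← Fin.sum_univ_eq_sum_range (fun i =>
      ((wordPoly a).map (iterateFrobenius F p (e - k))).coeff i * (wordPoly c).coeff i)]
  simp only [coeff_map, coeff_wordPoly, map_mul, map_pow]
  have : ∀ x : F, (iterateFrobenius F p (e - k) x) ^ p ^ k = x := fun x => by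
    rw [iterateFrobenius_def, ← pow_mul, ← pow_add, Nat.sub_add_cancel hk, ← hq,
      FiniteField.pow_card]
  simp only [this]

theorem mem_galoisDual_iff (hq : Fintype.card F = p ^ e) (hk : k ≤ e) (hn : 0 < n)
    {g h : F[X]} {lam : F} (hgh : g * h = X ^ n - C lam) (D : Submodule F (Fin n → F))
    (hD : ∀ c, c ∈ D ↔ g ∣ wordPoly c) (a : Fin n → F) :
    a ∈ galoisDual p k D ↔
      h ∣ reflect (n - 1) ((wordPoly a).map (iterateFrobenius F p (e - k))) := by
  have hdeg : (reflect (n - 1) ((wordPoly a).map (iterateFrobenius F p (e - k)))).degree < n := by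
    rw [degree_lt_iff_coeff_zero]
    intro i hi
    rw [coeff_reflect, revAt_eq_self_of_lt (by omega), coeff_map,
      coeff_eq_zero_of_degree_lt ((degree_wordPoly_lt a).trans_le (by exact_mod_cast hi)), map_zero]
  rw [← forall_coeff_mul_eq_zero_iff hn hgh hdeg]
  change (∀ c ∈ D, galoisInner p k a c = 0) ↔ _
  simp only [galoisInner_eq_zero_iff hq hk hn, hD]
  refine ⟨fun H Q hQ hgQ => ?_, fun H c hc => H _ (degree_wordPoly_lt c) hc⟩
  have := H (fun i => Q.coeff i)
  rw [wordPoly_coeff hQ] at this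
  exact this hgQ

/-- The hull of the code generated by `g`, when the cofactor of `g` is `hash G`. -/
theorem mem_galoisHull_iff (hq : Fintype.card F = p ^ e) (hk : k ≤ e) (hn : 0 < n)
    {g G : F[X]} {lam : F} (hgh : g * hash p e k G = X ^ n - C lam) (hG : G.coeff 0 ≠ 0)
    (D : Submodule F (Fin n → F)) (hD : ∀ c, c ∈ D ↔ g ∣ wordPoly c) (a : Fin n → F) :
    a ∈ galoisHull p k D ↔ g ∣ wordPoly a ∧ G ∣ wordPoly a := by
  rw [galoisHull, Submodule.mem_inf, hD, mem_galoisDual_iff hq hk hn hgh D hD,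
    hash_dvd_reflect_map hG]
  by_cases h0 : wordPoly a = 0
  · simp [h0]
  · have := (natDegree_lt_iff_degree_lt h0).2 (degree_wordPoly_lt a)
    omega

end Field

/-! ### The alphabet as a product of copies of `F` -/

section AlphabetDecomposition

variable {F : Type*} [Field F] {l : ℕ} (t : Fin l → F[X])

theorem eval_eq_zero_of_mem_rootTuples {ν : Fin l → F} (hν : ν ∈ rootTuples t) (i : Fin l) :
    (t i).eval (ν i) = 0 := by
  classical
  have := Fintype.mem_piFinset.1 hν i
  rw [rootFinset, Multiset.mem_toFinset] at this
  exact isRoot_of_mem_roots this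

/-- Evaluation of `𝒜` at a point of `H`. -/
noncomputable def pointEval {ν : Fin l → F} (hν : ν ∈ rootTuples t) : Alphabet t →ₐ[F] F :=
  Ideal.Quotient.liftₐ (relationIdeal t) (MvPolynomial.aeval ν) <| by
    have : relationIdeal t ≤ RingHom.ker (MvPolynomial.aeval ν : MvPolynomial (Fin l) F →ₐ[F] F) := by
      rw [relationIdeal, Ideal.span_le]
      rintro _ ⟨i, rfl⟩
      change MvPolynomial.aeval ν (aeval (MvPolynomial.X i) (t i)) = 0
      rw [← aeval_algHom_apply, MvPolynomial.aeval_X, coe_aeval_eq_eval,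
        eval_eq_zero_of_mem_rootTuples t hν]
    exact fun a ha => this ha

theorem pointEval_mk {ν : Fin l → F} (hν : ν ∈ rootTuples t) (a : MvPolynomial (Fin l) F) :
    pointEval t hν (Ideal.Quotient.mk (relationIdeal t) a) = MvPolynomial.aeval ν a := rfl

variable {t} [Fintype F]

theorem conjClass_eq_singleton {ν : Fin l → F} (hν : ν ∈ rootTuples t) : conjClass t ν = {ν} := by
  ext μ
  simp only [conjClass, Finset.mem_filter, Finset.mem_singleton, FiniteField.pow_card_pow]
  exact ⟨fun ⟨_, _, h⟩ => h, fun h => ⟨h ▸ hν, 0, h⟩⟩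

variable (t) in
theorem exists_mem_rootTuples (S : classes t) :
    ∃ ν ∈ rootTuples t, (S : Finset (Fin l → F)) = {ν} := by
  classical
  obtain ⟨ν, hν, h⟩ := Finset.mem_image.1 S.2
  exact ⟨ν, hν, by rw [← h, conjClass_eq_singleton hν]⟩

/-- The point of a class. -/
noncomputable def classPoint (S : classes t) : Fin l → F := (exists_mem_rootTuples t S).choose

theorem classPoint_mem (S : classes t) : classPoint S ∈ rootTuples t :=
  (exists_mem_rootTuples t S).choose_spec.1

theorem coe_eq_singleton_classPoint (S : classes t) :
    (S : Finset (Fin l → F)) = {classPoint S} :=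
  (exists_mem_rootTuples t S).choose_spec.2

theorem classPoint_injective : Function.Injective (classPoint : classes t → Fin l → F) := by
  intro S T h
  apply Subtype.ext
  rw [coe_eq_singleton_classPoint, h, ← coe_eq_singleton_classPoint]

theorem exists_classPoint_eq {ν : Fin l → F} (hν : ν ∈ rootTuples t) :
    ∃ S : classes t, classPoint S = ν := by
  classical
  refine ⟨⟨conjClass t ν, Finset.mem_image_of_mem _ hν⟩, ?_⟩
  have := coe_eq_singleton_classPoint (t := t) ⟨conjClass t ν, Finset.mem_image_of_mem _ hν⟩
  exact (Finset.singleton_injective ((conjClass_eq_singleton hν).symm.trans this)).symm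

/-- The coordinate `𝒜 → 𝔽_q` that belongs to a class. -/
noncomputable def classEval (S : classes t) : Alphabet t →ₐ[F] F := pointEval t (classPoint_mem S)

open Classical in
theorem classEval_classIdem (S T : classes t) :
    classEval S (classIdem t T) = if S = T then 1 else 0 := by
  have hmem : ∀ i, classPoint S i ∈ rootFinset t i := Fintype.mem_piFinset.1 (classPoint_mem S)
  have hmemT : ∀ i, classPoint T i ∈ rootFinset t i := Fintype.mem_piFinset.1 (classPoint_mem T)
  rw [classIdem, classEval, pointEval_mk, coe_eq_singleton_classPoint T, Finset.sum_singleton,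
    map_prod]
  simp only [← aeval_algHom_apply, MvPolynomial.aeval_X, coe_aeval_eq_eval]
  split_ifs with h
  · subst h
    refine Finset.prod_eq_one fun i _ => ?_
    exact Lagrange.eval_basis_self (v := id) Function.injective_id.injOn (hmem i)
  · obtain ⟨i, hi⟩ := Function.ne_iff.1 (classPoint_injective.ne h)
    refine Finset.prod_eq_zero (Finset.mem_univ i) ?_
    exact Lagrange.eval_basis_of_ne (v := id) (Ne.symm hi) (hmem i)

open Classical in
-- A polynomial and its Lagrange interpolant agree at the roots of `t i`. These are simple and lie
-- in `F`, so `t i` divides the difference, and `t i` vanishes at the class of `X i`.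
theorem aeval_mk_X_eq_sum (ht : ∀ i, Squarefree (t i)) (hsplit : ∀ i, (t i).Splits) (i : Fin l)
    (f : F[X]) :
    aeval (Ideal.Quotient.mk (relationIdeal t) (MvPolynomial.X i)) f =
      ∑ r ∈ rootFinset t i, f.eval r •
        aeval (Ideal.Quotient.mk (relationIdeal t) (MvPolynomial.X i))
          (Lagrange.basis (rootFinset t i) id r) := by
  have hnodup : (t i).roots.Nodup :=
    (nodup_roots_iff_of_splits (ht i).ne_zero (hsplit i)).2
      (PerfectField.separable_iff_squarefree.2 (ht i))
  have hdvd : t i ∣ f - ∑ r ∈ rootFinset t i, f.eval r • Lagrange.basis (rootFinset t i) id r := by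
    by_cases h0 : f - ∑ r ∈ rootFinset t i, f.eval r • Lagrange.basis (rootFinset t i) id r = 0
    · rw [h0]; exact dvd_zero _
    refine (hsplit i).dvd_of_roots_le_roots (ht i).ne_zero ((Multiset.le_iff_subset hnodup).2 ?_)
    intro s hs
    have hs' : s ∈ rootFinset t i := Multiset.mem_toFinset.2 hs
    have hbasis : ∀ r, (Lagrange.basis (rootFinset t i) id r).eval s = if r = s then 1 else 0 := by
      intro r
      split_ifs with h
      · subst h
        exact Lagrange.eval_basis_self (v := id) Function.injective_id.injOn hs'
      · exact Lagrange.eval_basis_of_ne (v := id) h hs'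
    rw [mem_roots h0, IsRoot.def, eval_sub, eval_finsetSum, sub_eq_zero]
    simp [eval_smul, hbasis, hs']
  obtain ⟨c, hc⟩ := hdvd
  have hz : aeval (Ideal.Quotient.mk (relationIdeal t) (MvPolynomial.X i)) (t i) = 0 := by
    have := aeval_algHom_apply (Ideal.Quotient.mkₐ F (relationIdeal t)) (MvPolynomial.X i) (t i)
    rw [Ideal.Quotient.mkₐ_eq_mk] at this
    rw [this]
    exact Ideal.Quotient.eq_zero_iff_mem.2 (Ideal.subset_span ⟨i, rfl⟩)
  have := congrArg (aeval (Ideal.Quotient.mk (relationIdeal t) (MvPolynomial.X i))) hc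
  rw [map_sub, map_mul, hz, zero_mul, sub_eq_zero] at this
  rw [this, map_sum]
  simp only [map_smul]

/-- Every element of `𝒜` is the combination of the idempotents with its coordinates. -/
theorem eq_sum_classEval (ht : ∀ i, Squarefree (t i)) (hsplit : ∀ i, (t i).Splits)
    (x : Alphabet t) : x = ∑ S, classEval S x • classIdem t S := by
  classical
  have hlin : (Ideal.Quotient.mkₐ F (relationIdeal t)).toLinearMap =
      ∑ S, ((LinearMap.toSpanSingleton F (Alphabet t) (classIdem t S)) ∘ₗ
        (classEval S).toLinearMap ∘ₗ (Ideal.Quotient.mkₐ F (relationIdeal t)).toLinearMap) := by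
    -- On a monomial both sides factor over the variables; expanding the product of one-variable
    -- interpolation formulas gives the sum over the points of `H`.
    refine MvPolynomial.linearMap_ext fun m => LinearMap.ext_ring ?_
    simp only [LinearMap.comp_apply, LinearMap.sum_apply, AlgHom.toLinearMap_apply,
      LinearMap.toSpanSingleton_apply]
    change Ideal.Quotient.mk (relationIdeal t) (MvPolynomial.monomial m (1 : F)) =
      ∑ S, classEval S (Ideal.Quotient.mk (relationIdeal t) (MvPolynomial.monomial m (1 : F))) •
        classIdem t S
    have h1 : Ideal.Quotient.mk (relationIdeal t) (MvPolynomial.monomial m (1 : F)) =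
        ∏ i, aeval (Ideal.Quotient.mk (relationIdeal t) (MvPolynomial.X i)) (X ^ m i : F[X]) := by
      rw [MvPolynomial.monomial_eq, map_one, one_mul, Finsupp.prod_fintype _ _ (by simp), map_prod]
      simp
    have h2 : ∀ S : classes t, classEval S
        (Ideal.Quotient.mk (relationIdeal t) (MvPolynomial.monomial m (1 : F))) =
          ∏ i, (X ^ m i : F[X]).eval (classPoint S i) := by
      intro S
      rw [classEval, pointEval_mk, MvPolynomial.monomial_eq, map_one, one_mul,
        Finsupp.prod_fintype _ _ (by simp), map_prod]
      simp
    have h3 : ∀ S : classes t, classIdem t S = ∏ i,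
        aeval (Ideal.Quotient.mk (relationIdeal t) (MvPolynomial.X i))
          (Lagrange.basis (rootFinset t i) id (classPoint S i)) := by
      intro S
      rw [classIdem, coe_eq_singleton_classPoint S, Finset.sum_singleton, map_prod]
      refine Finset.prod_congr rfl fun i _ => ?_
      exact (aeval_algHom_apply (Ideal.Quotient.mkₐ F (relationIdeal t)) (MvPolynomial.X i) _).symm
    rw [Finset.sum_congr rfl fun S _ => by rw [h2 S, h3 S, ← Finset.prod_smul], h1]
    simp only [aeval_mk_X_eq_sum ht hsplit _ (X ^ m _ : F[X])]
    rw [Finset.prod_univ_sum]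
    symm
    exact Finset.sum_bij (fun S _ => classPoint S) (fun S _ => classPoint_mem S)
      (fun S _ T _ h => classPoint_injective h)
      (fun ν hν => (exists_classPoint_eq hν).imp fun S h => ⟨Finset.mem_univ _, h⟩)
      fun _ _ => rfl
  obtain ⟨a, rfl⟩ := Ideal.Quotient.mk_surjective x
  simpa using LinearMap.congr_fun hlin a

end AlphabetDecomposition

/-! ### Decomposition of codes and hulls into components -/

section Components

variable {F : Type*} [Field F] [Fintype F] {l n : ℕ} {t : Fin l → F[X]}

open Classical in
theorem classEval_sum_smul_classIdem (S : classes t) (v : classes t → F) :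
    classEval S (∑ T, v T • classIdem t T) = v S := by
  simp [map_sum, classEval_classIdem]

theorem eq_of_classEval_eq (ht : ∀ i, Squarefree (t i)) (hsplit : ∀ i, (t i).Splits)
    {x y : Alphabet t} (h : ∀ S, classEval S x = classEval S y) : x = y := by
  rw [eq_sum_classEval ht hsplit x, eq_sum_classEval ht hsplit y]
  simp only [h]

/-- The component of a word at a class. -/
noncomputable def component (S : classes t) : (Fin n → Alphabet t) →ₗ[F] (Fin n → F) :=
  (classEval S).toLinearMap.compLeft (Fin n)

theorem component_apply (S : classes t) (a : Fin n → Alphabet t) (i : Fin n) :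
    component S a i = classEval S (a i) := rfl

/-- The component `C_S` as a subspace. -/
noncomputable def componentCode (C : Submodule (Alphabet t) (Fin n → Alphabet t)) (S : classes t) :
    Submodule F (Fin n → F) :=
  (C.restrictScalars F).map (component S)

theorem mem_componentCode {C : Submodule (Alphabet t) (Fin n → Alphabet t)} {S : classes t}
    {v : Fin n → F} : v ∈ componentCode C S ↔ ∃ ρ ∈ C, component S ρ = v := Iff.rfl

theorem projCode_eq (ht : ∀ i, Squarefree (t i)) (hsplit : ∀ i, (t i).Splits)
    (C : Submodule (Alphabet t) (Fin n → Alphabet t)) (S : classes t) :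
    projCode t C S = componentCode C S := by
  ext v
  rw [SetLike.mem_coe, mem_componentCode]
  constructor
  · rintro ⟨ρ, hρ, c, hc, rfl⟩
    refine ⟨ρ, hρ, ?_⟩
    ext i
    rw [component_apply, hc, classEval_sum_smul_classIdem S fun T => c T i]
  · rintro ⟨ρ, hρ, rfl⟩
    exact ⟨ρ, hρ, fun T => component T ρ, fun i => eq_sum_classEval ht hsplit (ρ i), rfl⟩

/-- An `𝒜`-submodule is closed under multiplication by the idempotents, so codewords chosen
separately for each class can be glued. -/
theorem mem_iff_forall_component_mem (ht : ∀ i, Squarefree (t i)) (hsplit : ∀ i, (t i).Splits)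
    (C : Submodule (Alphabet t) (Fin n → Alphabet t)) (a : Fin n → Alphabet t) :
    a ∈ C ↔ ∀ S, component S a ∈ componentCode C S := by
  classical
  refine ⟨fun h S => ⟨a, h, rfl⟩, fun h => ?_⟩
  choose ρ hρ hρa using h
  have : a = ∑ S, classIdem t S • ρ S := by
    ext i
    refine eq_of_classEval_eq ht hsplit fun T => ?_
    have := congrFun (hρa T) i
    rw [component_apply, component_apply] at this
    simp [Finset.sum_apply, map_sum, classEval_classIdem, this]
  rw [this]
  exact C.sum_mem fun S _ => C.smul_mem _ (hρ S)

theorem classEval_galoisInner (p k : ℕ) (S : classes t) (a c : Fin n → Alphabet t) :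
    classEval S (galoisInner p k a c) = galoisInner p k (component S a) (component S c) := by
  simp [galoisInner, map_sum, component_apply]

theorem mem_galoisHull_iff_forall_component (ht : ∀ i, Squarefree (t i))
    (hsplit : ∀ i, (t i).Splits) (p k : ℕ) (C : Submodule (Alphabet t) (Fin n → Alphabet t))
    (a : Fin n → Alphabet t) :
    a ∈ galoisHull p k C ↔ ∀ S, component S a ∈ galoisHull p k (componentCode C S) := by
  have hdual : a ∈ galoisDual p k C ↔ ∀ S, component S a ∈ galoisDual p k (componentCode C S) := by
    constructor
    · rintro h S _ ⟨ρ, hρ, rfl⟩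
      rw [← classEval_galoisInner, h ρ hρ, map_zero]
    · intro h c hc
      refine eq_of_classEval_eq ht hsplit fun S => ?_
      rw [classEval_galoisInner, map_zero]
      exact h S _ ⟨c, hc, rfl⟩
  simp only [galoisHull, Submodule.mem_inf, hdual, mem_iff_forall_component_mem ht hsplit C a,
    forall_and]

theorem finrank_galoisHull (ht : ∀ i, Squarefree (t i)) (hsplit : ∀ i, (t i).Splits) (p k : ℕ)
    (C : Submodule (Alphabet t) (Fin n → Alphabet t)) :
    Module.finrank F (galoisHull p k C) =
      ∑ S, Module.finrank F (galoisHull p k (componentCode C S)) := by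
  rw [← Module.finrank_pi_fintype]
  let f : galoisHull p k C →ₗ[F] ∀ S, galoisHull p k (componentCode C S) :=
    { toFun := fun a S =>
        ⟨component S a, (mem_galoisHull_iff_forall_component ht hsplit p k C a).1 a.2 S⟩
      map_add' := fun a b => by
        ext S i
        simp
      map_smul' := fun x a => by
        ext S i
        simp [component_apply] }
  refine (LinearEquiv.ofBijective f ⟨fun a b h => ?_, fun v => ?_⟩).finrank_eq
  · ext i
    refine eq_of_classEval_eq ht hsplit fun S => ?_
    exact congrFun (congrArg Subtype.val (congrFun h S)) i
  · have hv : ∀ S, component S (fun i => ∑ T, (v T : Fin n → F) i • classIdem t T) = v S :=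
      fun S => funext fun i => classEval_sum_smul_classIdem S fun T => (v T : Fin n → F) i
    refine ⟨⟨fun i => ∑ T, (v T : Fin n → F) i • classIdem t T,
      (mem_galoisHull_iff_forall_component ht hsplit p k C _).2 fun S => ?_⟩, ?_⟩
    · rw [hv]; exact (v S).2
    · funext S
      exact Subtype.ext (hv S)

/-- The ideal is pulled back to `R[x]` and pushed forward to the principal ideal domain `K[x]`; the
image contains `x^n - φ lam`, so its monic generator divides it. -/
theorem exists_monic_generator {R K : Type*} [CommRing R] [Field K] {n : ℕ} (hn : 0 < n)
    (φ : R →+* K) (hφ : Function.Surjective φ) (lam : R) (D : Submodule R (Fin n → R))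
    (hD : IsConstacyclic lam D) :
    ∃ g : K[X], g.Monic ∧ g ∣ X ^ n - C (φ lam) ∧
      ∀ c : Fin n → K, (∃ ρ ∈ D, (fun i => φ (ρ i)) = c) ↔ g ∣ wordPoly c := by
  classical
  have : Nontrivial R := φ.domain_nontrivial
  obtain ⟨J, hJ⟩ := hD
  let q := Ideal.Quotient.mk (Ideal.span {(X ^ n - C lam : R[X])})
  have hmon : (X ^ n - C lam : R[X]).Monic := monic_X_pow_sub_C lam hn.ne'
  have hmap : (X ^ n - C lam : R[X]).map φ = X ^ n - C (φ lam) := by simp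
  have hsurj : Function.Surjective (mapRingHom φ) := map_surjective φ hφ
  let I : Ideal K[X] := (J.comap q).map (mapRingHom φ)
  have hmem : X ^ n - C (φ lam) ∈ I := by
    rw [← hmap]
    refine Ideal.mem_map_of_mem (mapRingHom φ) (Ideal.mem_comap.2 ?_)
    have h0 : q (X ^ n - C lam) = 0 :=
      Ideal.Quotient.eq_zero_iff_mem.2 (Ideal.mem_span_singleton_self _)
    rw [h0]
    exact J.zero_mem
  obtain ⟨g₀, hg₀⟩ := (IsPrincipalIdealRing.principal I).principal
  have hg₀' : ∀ f, f ∈ I ↔ g₀ ∣ f := fun f => by rw [hg₀]; exact Ideal.mem_span_singleton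
  have hne : g₀ ≠ 0 := by
    rintro rfl
    exact X_pow_sub_C_ne_zero hn (φ lam) (zero_dvd_iff.1 ((hg₀' _).1 hmem))
  have hg : ∀ f, f ∈ I ↔ normalize g₀ ∣ f := fun f => by rw [hg₀', normalize_dvd_iff]
  refine ⟨normalize g₀, monic_normalize hne, (hg _).1 hmem, fun c => ?_⟩
  rw [← hg, Ideal.mem_map_iff_of_surjective _ hsurj]
  constructor
  · rintro ⟨ρ, hρ, rfl⟩
    exact ⟨wordPoly ρ, (hJ ρ).1 hρ, map_wordPoly φ ρ⟩
  · rintro ⟨Q, hQ, hQc⟩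
    -- A preimage may have large degree. Its remainder already over `R`, where `x^n - lam` is monic,
    -- is a codeword with the same image, as `wordPoly c` is reduced.
    have hdeg : (Q %ₘ (X ^ n - C lam)).degree < n := by
      simpa [degree_X_pow_sub_C hn] using degree_modByMonic_lt Q hmon
    refine ⟨fun i => (Q %ₘ (X ^ n - C lam)).coeff i, (hJ _).2 ?_, wordPoly_injective ?_⟩
    · rw [wordClass, wordPoly_coeff hdeg]
      have : q (Q %ₘ (X ^ n - C lam)) = q Q := by
        rw [Ideal.Quotient.mk_eq_mk_iff_sub_mem, Ideal.mem_span_singleton, ← dvd_neg, neg_sub]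
        exact ⟨Q /ₘ (X ^ n - C lam), by linear_combination -modByMonic_add_div Q (X ^ n - C lam)⟩
      exact this ▸ hQ
    · rw [← map_wordPoly, wordPoly_coeff hdeg, map_modByMonic φ hmon, hmap]
      have : Q.map φ = wordPoly c := hQc
      rw [this, modByMonic_eq_self_iff (hmap ▸ hmon.map φ), degree_X_pow_sub_C hn]
      exact degree_wordPoly_lt c

end Components

/-! ### Orbits of `#` on minimal polynomials -/

section Orbits

variable {F K : Type*} [Field F] [Fintype F] [Field K] [Algebra F K] [Algebra.IsIntegral F K]
  {p e k : ℕ} [hp : Fact p.Prime] [CharP F p]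

omit [Fintype F] [Algebra.IsIntegral F K] hp [CharP F p] in
theorem minpoly_dvd_cyclotomic {α : Kˣ} (h : 0 < orderOf α) :
    minpoly F (α : K) ∣ cyclotomic (orderOf α) F := by
  refine minpoly.dvd F _ ?_
  have h1 := IsPrimitiveRoot.orderOf (α : K)
  rw [orderOf_units] at h1
  have := h1.isRoot_cyclotomic h
  rwa [← map_cyclotomic (orderOf α) (algebraMap F K), IsRoot.def, eval_map_algebraMap] at this

omit [CharP F p] in
theorem natDegree_of_dvd_cyclotomic (hq : Fintype.card F = p ^ e) {j : ℕ} (hj : p.Coprime j)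
    {f : F[X]} (hf : Irreducible f) (hd : f ∣ cyclotomic j F) : f.natDegree = ordMod j (p ^ e) := by
  rw [natDegree_of_dvd_cyclotomic_of_irreducible hq hj hd hf, ← orderOf_units,
    ZMod.coe_unitOfCoprime, ordMod]

omit [CharP F p] in
theorem natDegree_minpoly_unit (hq : Fintype.card F = p ^ e) {α : Kˣ} (hj : p.Coprime (orderOf α)) :
    (minpoly F (α : K)).natDegree = ordMod (orderOf α) (p ^ e) := by
  have hpos : 0 < orderOf α := Nat.pos_of_ne_zero fun h => by
    rw [h, Nat.coprime_zero_right] at hj; exact hp.out.one_lt.ne' hj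
  exact natDegree_of_dvd_cyclotomic hq hj (minpoly.irreducible (Algebra.IsIntegral.isIntegral _))
    (minpoly_dvd_cyclotomic hpos)

omit [Fintype F] [Algebra.IsIntegral F K] in
-- In characteristic `p` the twisted polynomial takes the value `f(α)^{p^{e-k}} = 0` at
-- `α^{p^{e-k}}`, and reversal inverts roots.
theorem aeval_hash {f : F[X]} {α : Kˣ} (h : aeval (α : K) f = 0) :
    aeval (((α ^ p ^ (e - k))⁻¹ : Kˣ) : K) (hash p e k f) = 0 := by
  have : CharP K p := charP_of_injective_algebraMap (algebraMap F K).injective p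
  have hsum : ∑ i ∈ Finset.range (f.natDegree + 1),
      algebraMap F K (f.coeff i ^ p ^ (e - k)) * ((α : K) ^ p ^ (e - k)) ^ i = 0 := by
    have h1 : ∀ i, algebraMap F K (f.coeff i ^ p ^ (e - k)) * ((α : K) ^ p ^ (e - k)) ^ i =
        (f.coeff i • (α : K) ^ i) ^ p ^ (e - k) := fun i => by
      rw [Algebra.smul_def, mul_pow, map_pow, ← pow_mul, ← pow_mul, mul_comm i]
    simp only [h1]
    rw [← sum_pow_char_pow p, ← aeval_eq_sum_range, h,
      zero_pow (pow_ne_zero _ hp.out.ne_zero)]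
  have h2 : ∀ i ∈ Finset.range (f.natDegree + 1),
      aeval (((α ^ p ^ (e - k))⁻¹ : Kˣ) : K)
        (C ((f.coeff 0 ^ p ^ (e - k))⁻¹ * f.coeff i ^ p ^ (e - k)) * X ^ (f.natDegree - i)) =
      algebraMap F K (f.coeff 0 ^ p ^ (e - k))⁻¹ * (((α : K) ^ p ^ (e - k)) ^ f.natDegree)⁻¹ *
        (algebraMap F K (f.coeff i ^ p ^ (e - k)) * ((α : K) ^ p ^ (e - k)) ^ i) := by
    intro i hi
    have hα : (α : K) ^ p ^ (e - k) ≠ 0 := pow_ne_zero _ α.ne_zero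
    have hi' : i ≤ f.natDegree := by simpa [Nat.lt_succ_iff] using hi
    have h3 : ((α : K) ^ p ^ (e - k)) ^ f.natDegree =
        ((α : K) ^ p ^ (e - k)) ^ (f.natDegree - i) * ((α : K) ^ p ^ (e - k)) ^ i := by
      rw [← pow_add, Nat.sub_add_cancel hi']
    rw [map_mul, aeval_C, map_pow, aeval_X, map_mul, h3, Units.val_inv_eq_inv_val,
      Units.val_pow_eq_pow_val, inv_pow]
    field_simp
  rw [hash, map_sum, Finset.sum_congr rfl h2, ← Finset.mul_sum, hsum, mul_zero]

theorem hash_minpoly (hq : Fintype.card F = p ^ e) {α : Kˣ} (hj : p.Coprime (orderOf α)) :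
    hash p e k (minpoly F (α : K)) = minpoly F (((α ^ p ^ (e - k))⁻¹ : Kˣ) : K) := by
  have h0 : (minpoly F (α : K)).coeff 0 ≠ 0 :=
    minpoly.coeff_zero_ne_zero (Algebra.IsIntegral.isIntegral _) α.ne_zero
  have hord : orderOf ((α ^ p ^ (e - k))⁻¹ : Kˣ) = orderOf α := by
    rw [orderOf_inv, Nat.Coprime.orderOf_pow (hj.symm.pow_right _)]
  refine (eq_of_monic_of_dvd_of_natDegree_le (minpoly.monic (Algebra.IsIntegral.isIntegral _))
    (monic_hash h0) (minpoly.dvd F _ (aeval_hash (minpoly.aeval F _))) ?_)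
  rw [natDegree_hash h0, natDegree_minpoly_unit hq hj, natDegree_minpoly_unit hq (by rwa [hord]),
    hord]

omit [CharP F p] in
-- The powers `α^{q^m}` with `m < ord_j(q)`, `j` the order of `α`, are distinct roots of the minimal
-- polynomial, whose degree is `ord_j(q)`. So they are all its roots.
theorem minpoly_eq_minpoly_iff (hq : Fintype.card F = p ^ e) {α β : Kˣ}
    (hj : p.Coprime (orderOf α)) :
    minpoly F (β : K) = minpoly F (α : K) ↔ ∃ m : ℕ, β = α ^ (p ^ e) ^ m := by
  classical
  have hconj : ∀ m : ℕ, minpoly F ((α ^ (p ^ e) ^ m : Kˣ) : K) = minpoly F (α : K) := by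
    intro m
    induction m with
    | zero => simp
    | succ m ih =>
      have h1 := minpoly.algHom_eq (FiniteField.frobeniusAlgHom F K) (RingHom.injective _)
        ((α ^ (p ^ e) ^ m : Kˣ) : K)
      rw [← ih, ← h1, FiniteField.coe_frobeniusAlgHom]
      simp only [hq, ← Units.val_pow_eq_pow_val, ← pow_mul, mul_one, pow_add]
  refine ⟨fun h => ?_, fun ⟨m, hm⟩ => hm ▸ hconj m⟩
  set f := minpoly F (α : K) with hf
  have hint := Algebra.IsIntegral.isIntegral (R := F) (α : K)
  have hinj : Set.InjOn (fun m => ((α ^ (p ^ e) ^ m : Kˣ) : K))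
      (Finset.range (ordMod (orderOf α) (p ^ e))) := by
    intro m hm m' hm' hmm
    have h1 := pow_eq_pow_iff_modEq.1 (Units.ext hmm)
    rw [← ZMod.natCast_eq_natCast_iff, Nat.cast_pow, Nat.cast_pow] at h1
    exact pow_injOn_Iio_orderOf (by simpa [ordMod] using hm) (by simpa [ordMod] using hm')
      (by simpa using h1)
  have hroot : ∀ x : K, x ∈ (f.aroots K).toFinset ↔ aeval x f = 0 := fun x => by
    rw [Multiset.mem_toFinset, mem_aroots]
    exact and_iff_right (minpoly.ne_zero hint)
  have hsub : (Finset.range (ordMod (orderOf α) (p ^ e))).image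
      (fun m => ((α ^ (p ^ e) ^ m : Kˣ) : K)) ⊆ (f.aroots K).toFinset := by
    intro x hx
    obtain ⟨m, _, rfl⟩ := Finset.mem_image.1 hx
    rw [hroot, ← hconj m]
    exact minpoly.aeval F _
  have heq := Finset.eq_of_subset_of_card_le hsub (by
    rw [Finset.card_image_of_injOn hinj, Finset.card_range, ← natDegree_minpoly_unit hq hj]
    refine (Multiset.toFinset_card_le _).trans ((card_roots' _).trans ?_)
    rw [natDegree_map])
  have hβ : (β : K) ∈ (f.aroots K).toFinset := by
    rw [hroot, ← h]
    exact minpoly.aeval F _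
  rw [← heq] at hβ
  obtain ⟨m, _, hm⟩ := Finset.mem_image.1 hβ
  exact ⟨m, (Units.ext hm).symm⟩

omit hp in
theorem zpow_neg_prime_pow {G : Type*} [Group G] (x : G) :
    x ^ (-(p : ℤ) ^ (e - k)) = (x ^ p ^ (e - k))⁻¹ := by
  rw [zpow_neg, ← zpow_natCast]
  push_cast
  rfl

omit hp in
theorem orderOf_zpow_neg_prime_pow {α : Kˣ} (hj : p.Coprime (orderOf α)) (i : ℕ) :
    orderOf (α ^ (-(p : ℤ) ^ (e - k)) ^ i) = orderOf α := by
  induction i with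
  | zero => simp
  | succ i ih =>
    rw [pow_succ, zpow_mul, zpow_neg_prime_pow, orderOf_inv, Nat.Coprime.orderOf_pow, ih]
    rw [ih]; exact hj.symm.pow_right _

theorem hash_iterate_minpoly (hq : Fintype.card F = p ^ e) {α : Kˣ} (hj : p.Coprime (orderOf α))
    (i : ℕ) : (hash p e k)^[i] (minpoly F (α : K)) =
      minpoly F ((α ^ (-(p : ℤ) ^ (e - k)) ^ i : Kˣ) : K) := by
  induction i with
  | zero => simp
  | succ i ih =>
    rw [Function.iterate_succ_apply', ih,
      hash_minpoly hq (by rwa [orderOf_zpow_neg_prime_pow hj]), pow_succ, zpow_mul, zpow_neg_prime_pow]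

/-- The iterate has root `α^{(-p^{e-k})^i}`, which is conjugate to `α` iff the order of `α` divides
some `q^m - (-p^{e-k})^i`. Only the order of `α` matters. -/
theorem hash_iterate_minpoly_eq_iff (hq : Fintype.card F = p ^ e) {α : Kˣ}
    (hj : p.Coprime (orderOf α)) {i : ℕ} (hi : 0 < i) :
    (hash p e k)^[i] (minpoly F (α : K)) = minpoly F (α : K) ↔
      ∃ m : ℕ, (orderOf α : ℤ) ∣
        (p : ℤ) ^ (e * m) + (-1) ^ (i - 1) * (p : ℤ) ^ (i * (e - k)) := by
  rw [hash_iterate_minpoly hq hj, minpoly_eq_minpoly_iff hq hj]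
  refine exists_congr fun m => ?_
  have h1 : (p : ℤ) ^ (e * m) + (-1) ^ (i - 1) * (p : ℤ) ^ (i * (e - k)) =
      ((((p ^ e) ^ m : ℕ) : ℕ) : ℤ) - (-(p : ℤ) ^ (e - k)) ^ i := by
    obtain ⟨i, rfl⟩ := Nat.exists_eq_add_of_lt hi
    push_cast
    simp only [zero_add]
    rw [neg_pow ((p : ℤ) ^ (e - k)), pow_succ (-1 : ℤ), ← pow_mul, ← pow_mul, mul_comm (e - k)]
    ring
  rw [h1, orderOf_dvd_sub_iff_zpow_eq_zpow, zpow_natCast, eq_comm]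

theorem mem_setB_iff_isLeast (hq : Fintype.card F = p ^ e) {α : Kˣ}
    (hj : p.Coprime (orderOf α)) (a : ℕ) :
    orderOf α ∈ setB p e k a ↔ IsLeast {i | 0 < i ∧
      (hash p e k)^[i] (minpoly F (α : K)) = minpoly F (α : K)} a := by
  have : {i : ℕ | 0 < i ∧ (hash p e k)^[i] (minpoly F (α : K)) = minpoly F (α : K)} =
      {i' : ℕ | 0 < i' ∧ ∃ m : ℕ, (orderOf α : ℤ) ∣
        (p : ℤ) ^ (e * m) + (-1) ^ (i' - 1) * (p : ℤ) ^ (i' * (e - k))} := by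
    ext i
    exact and_congr_right fun hi => hash_iterate_minpoly_eq_iff hq hj hi
  rw [this]
  rfl

omit hp in
-- These facts make `(-p^{e-k})^l` a power of `q`: evenness removes the sign. Hence `l` is a period
-- of `#`.
theorem hashPeriod_spec (hk : k < e) : 0 < hashPeriod e k ∧ Even (hashPeriod e k) ∧
    e ∣ hashPeriod e k * (e - k) := by
  set A := {m : ℕ | 0 < m ∧ Nat.lcm e (e - k) ∣ m ∧ Even (m / (e - k))} with hA
  have hek : 0 < e - k := by omega
  have hlcm : 0 < Nat.lcm e (e - k) := Nat.lcm_pos (by omega) hek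
  have hmem : sInf A ∈ A := by
    refine Nat.sInf_mem ⟨2 * Nat.lcm e (e - k), by positivity, dvd_mul_left _ _, ?_⟩
    rw [Nat.mul_div_assoc _ (Nat.dvd_lcm_right _ _)]
    exact even_two_mul _
  obtain ⟨h1, h2, h3⟩ := hmem
  have h4 : e - k ∣ sInf A := (Nat.dvd_lcm_right _ _).trans h2
  refine ⟨Nat.div_pos (Nat.le_of_dvd h1 h4) hek, h3, ?_⟩
  rw [hashPeriod, Nat.div_mul_cancel h4]
  exact (Nat.dvd_lcm_left _ _).trans h2

theorem hash_iterate_hashPeriod (hq : Fintype.card F = p ^ e) (hk : k < e) {α : Kˣ}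
    (hj : p.Coprime (orderOf α)) :
    (hash p e k)^[hashPeriod e k] (minpoly F (α : K)) = minpoly F (α : K) := by
  obtain ⟨-, h2, m, h3⟩ := hashPeriod_spec hk
  rw [hash_iterate_minpoly hq hj, minpoly_eq_minpoly_iff hq hj]
  refine ⟨m, ?_⟩
  rw [h2.neg_pow, ← pow_mul, mul_comm (e - k), h3, ← zpow_natCast, ← pow_mul]
  push_cast
  rfl

/-- The order `j` of `α` lies in `B_a` iff `a` is the length of the `#`-orbit of the minimal
polynomial of `α`. -/
theorem mem_setB_iff_eq_minimalPeriod (hq : Fintype.card F = p ^ e) (hk : k < e) {α : Kˣ}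
    (hj : p.Coprime (orderOf α)) (a : ℕ) : orderOf α ∈ setB p e k a ↔
      a = Function.minimalPeriod (hash p e k) (minpoly F (α : K)) := by
  rw [mem_setB_iff_isLeast hq hj]
  have hper : minpoly F (α : K) ∈ Function.periodicPts (hash p e k) :=
    ⟨_, (hashPeriod_spec hk).1, hash_iterate_hashPeriod hq hk hj⟩
  have hleast : IsLeast {i | 0 < i ∧
      (hash p e k)^[i] (minpoly F (α : K)) = minpoly F (α : K)}
      (Function.minimalPeriod (hash p e k) (minpoly F (α : K))) :=
    ⟨⟨Function.minimalPeriod_pos_of_mem_periodicPts hper, Function.iterate_minimalPeriod⟩,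
      fun i hi => Function.IsPeriodicPt.minimalPeriod_le hi.1 hi.2⟩
  exact ⟨fun h => h.unique hleast, fun h => h ▸ hleast⟩

theorem minimalPeriod_mem_divisors (hq : Fintype.card F = p ^ e) (hk : k < e) {α : Kˣ}
    (hj : p.Coprime (orderOf α)) :
    Function.minimalPeriod (hash p e k) (minpoly F (α : K)) ∈ (hashPeriod e k).divisors :=
  Nat.mem_divisors.2 ⟨Function.IsPeriodicPt.minimalPeriod_dvd (hash_iterate_hashPeriod hq hk hj),
    (hashPeriod_spec hk).1.ne'⟩

end Orbits

/-- A finite set that is stable under `h`, all whose points have period `a`, is a disjoint union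
of orbits. -/
theorem exists_orbit_representatives {α M : Type*} [Nonempty α] [CommMonoid M] (h : α → α) {a : ℕ}
    (ha : 0 < a) (φ : α → M) (s : Finset α) (hs : ∀ x ∈ s, h x ∈ s)
    (hper : ∀ x ∈ s, Function.minimalPeriod h x = a) :
    a ∣ s.card ∧ ∃ r : ℕ → α, (∀ i < s.card / a, r i ∈ s) ∧
      ∏ i ∈ Finset.range (s.card / a), ∏ δ ∈ Finset.range a, φ (h^[δ] (r i)) = ∏ x ∈ s, φ x := by
  classical
  induction hc : s.card using Nat.strong_induction_on generalizing s with
  | _ c ih =>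
  rcases s.eq_empty_or_nonempty with rfl | ⟨x, hx⟩
  · obtain rfl : 0 = c := by simpa using hc
    exact ⟨dvd_zero _, fun _ => Classical.arbitrary α, by simp, by simp⟩
  have hinj : Set.InjOn (fun δ => h^[δ] x) (Finset.range a) := by
    have := Function.iterate_injOn_Iio_minimalPeriod (f := h) (x := x)
    rw [hper x hx] at this
    simpa using this
  have hiter : ∀ y ∈ s, ∀ i, h^[i] y ∈ s := by
    intro y hy i
    induction i with
    | zero => exact hy
    | succ i ih => rw [Function.iterate_succ_apply']; exact hs _ ih
  have hmod : ∀ i, h^[i] x ∈ (Finset.range a).image fun δ => h^[δ] x := fun i =>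
    Finset.mem_image.2 ⟨i % a, Finset.mem_range.2 (Nat.mod_lt _ ha), by
      rw [← hper x hx, Function.iterate_mod_minimalPeriod_eq]⟩
  set O := (Finset.range a).image fun δ => h^[δ] x with hO
  have hOs : O ⊆ s := by
    intro y hy
    obtain ⟨i, -, rfl⟩ := Finset.mem_image.1 hy
    exact hiter x hx i
  have hOc : O.card = a := by rw [hO, Finset.card_image_of_injOn hinj, Finset.card_range]
  have hcard : (s \ O).card + a = c := by
    rw [← hc, ← hOc]; exact Finset.card_sdiff_add_card_eq_card hOs
  -- On points of period `a`, `h^[a - 1]` undoes `h`, so a point mapped into the orbit already lies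
  -- in it.
  have hstable : ∀ y ∈ s \ O, h y ∈ s \ O := by
    intro y hy
    rw [Finset.mem_sdiff] at hy ⊢
    refine ⟨hs y hy.1, fun hyO => hy.2 ?_⟩
    obtain ⟨i, -, hi⟩ := Finset.mem_image.1 hyO
    have h1 : h^[a] y = y := by rw [← hper y hy.1]; exact Function.iterate_minimalPeriod
    obtain ⟨b, rfl⟩ := Nat.exists_eq_succ_of_ne_zero ha.ne'
    rw [Function.iterate_succ_apply, ← hi, ← Function.iterate_add_apply] at h1
    rw [← h1]
    exact hmod _
  obtain ⟨hd, r, hr, hprod⟩ := ih (s \ O).card (by omega) (s \ O) hstable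
    (fun y hy => hper y (Finset.mem_sdiff.1 hy).1) rfl
  have hdiv : c / a = (s \ O).card / a + 1 := by rw [← hcard, Nat.add_div_right _ ha]
  refine ⟨by rw [← hcard]; exact dvd_add hd dvd_rfl,
    fun i => if i < (s \ O).card / a then r i else x, fun i hi => ?_, ?_⟩
  · dsimp only
    split_ifs with h1
    · exact (Finset.mem_sdiff.1 (hr i h1)).1
    · exact hx
  · rw [hdiv, Finset.prod_range_succ]
    dsimp only
    rw [if_neg (lt_irrefl _), ← Finset.prod_sdiff hOs, ← hprod, hO,
      Finset.prod_image hinj]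
    congr 1
    refine Finset.prod_congr rfl fun i hi => ?_
    rw [if_pos (Finset.mem_range.1 hi)]

/-! ### The `#`-orbit factorization of `x^n - λ` -/

section Factorization

variable {F : Type*} [Field F] [Fintype F] {p e k : ℕ} [hp : Fact p.Prime]

open Classical in
/-- The minimal polynomials of the products of `b` with the primitive `d`-th roots of unity. -/
noncomputable def twistedFactors (b : Fˣ) (d : ℕ) : Finset F[X] :=
  (primitiveRoots d (AlgebraicClosure F)).image fun ζ =>
    minpoly F (algebraMap F (AlgebraicClosure F) b * ζ)

omit [Fintype F] in
theorem mem_twistedFactors {b : Fˣ} {d : ℕ} (hd : 0 < d) {f : F[X]} :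
    f ∈ twistedFactors b d ↔ ∃ z : (AlgebraicClosure F)ˣ, orderOf z = d ∧
      f = minpoly F ((Units.map (algebraMap F (AlgebraicClosure F)).toMonoidHom b * z :
        (AlgebraicClosure F)ˣ) : AlgebraicClosure F) := by
  simp only [twistedFactors, Finset.mem_image, mem_primitiveRoots hd]
  constructor
  · rintro ⟨ζ, hζ, rfl⟩
    obtain ⟨z, rfl⟩ := hζ.isUnit hd.ne'
    exact ⟨z, (IsPrimitiveRoot.coe_units_iff.1 hζ).eq_orderOf.symm, rfl⟩
  · rintro ⟨z, rfl, rfl⟩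
    exact ⟨z, IsPrimitiveRoot.coe_units_iff.2 (IsPrimitiveRoot.orderOf z), rfl⟩

omit [Fintype F] in
theorem orderOf_twist {b : Fˣ} {z : (AlgebraicClosure F)ˣ}
    (h : (orderOf b).Coprime (orderOf z)) :
    orderOf (Units.map (algebraMap F (AlgebraicClosure F)).toMonoidHom b * z) =
      orderOf b * orderOf z := by
  have : orderOf (Units.map (algebraMap F (AlgebraicClosure F)).toMonoidHom b) = orderOf b :=
    orderOf_injective _ (Units.map_injective (algebraMap F (AlgebraicClosure F)).injective) b
  rw [(Commute.all _ _).orderOf_mul_eq_mul_orderOf_of_coprime (by rwa [this]), this]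

/-- Group the `ζ` by the minimal polynomial of `bζ`. As `b` is fixed by the `q`-power map, the
conjugates of `bζ` are the `b ζ^{q^m}`, again with primitive `d`-th roots of unity, so each group
exhausts the roots of its polynomial. -/
theorem prod_map_twistedFactors (hq : Fintype.card F = p ^ e) {b : Fˣ} {d : ℕ} (hd : 0 < d)
    (hbd : (orderOf b).Coprime d) (hpj : p.Coprime (orderOf b * d)) :
    (∏ f ∈ twistedFactors b d, f).map (algebraMap F (AlgebraicClosure F)) =
      ∏ ζ ∈ primitiveRoots d (AlgebraicClosure F),
        (X - C (algebraMap F (AlgebraicClosure F) b * ζ)) := by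
  classical
  set K := AlgebraicClosure F
  rw [Polynomial.map_prod, ← Finset.prod_fiberwise_of_maps_to
    (t := twistedFactors b d) (fun ζ hζ => Finset.mem_image_of_mem _ hζ)]
  refine Finset.prod_congr rfl fun f hf => ?_
  obtain ⟨z, hz, hfz⟩ := (mem_twistedFactors hd).1 hf
  set u := Units.map (algebraMap F K).toMonoidHom b * z with hu
  have hord : orderOf u = orderOf b * d := by rw [hu, orderOf_twist (by rwa [hz]), hz]
  have hint := Algebra.IsIntegral.isIntegral (R := F) (u : K)
  have hmonic : f.Monic := hfz ▸ minpoly.monic hint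
  have hirr : Irreducible f := hfz ▸ minpoly.irreducible hint
  have hnodup : (f.aroots K).Nodup :=
    nodup_roots (PerfectField.separable_of_irreducible hirr).map
  have hb0 : algebraMap F K b ≠ 0 := by simp
  have hroots : (f.aroots K).toFinset = (Finset.filter (fun ζ => minpoly F (algebraMap F K b * ζ) = f)
      (primitiveRoots d K)).image fun ζ => algebraMap F K b * ζ := by
    ext x
    rw [Multiset.mem_toFinset, mem_aroots, and_iff_right hirr.ne_zero, Finset.mem_image]
    constructor
    · intro hx
      have hx0 : x ≠ 0 := by
        rintro rfl
        rw [← coeff_zero_eq_aeval_zero', hfz, map_eq_zero] at hx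
        exact minpoly.coeff_zero_ne_zero hint u.ne_zero hx
      have hmin : minpoly F x = f := (minpoly.eq_of_irreducible_of_monic hirr hx hmonic).symm
      obtain ⟨m, hm⟩ := (minpoly_eq_minpoly_iff (α := u) (β := Units.mk0 x hx0) hq
        (by rwa [hord])).1 (by rw [← hfz]; exact hmin)
      have hbq : (algebraMap F K b) ^ (p ^ e) ^ m = algebraMap F K b := by
        rw [← map_pow, ← hq, FiniteField.pow_card_pow]
      have hxz : algebraMap F K b * ((z ^ (p ^ e) ^ m : Kˣ) : K) = x := by
        have := congrArg Units.val hm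
        rw [Units.val_mk0, hu, mul_pow, Units.val_mul] at this
        rw [this, Units.val_pow_eq_pow_val]
        exact congrArg (· * _) hbq.symm
      refine ⟨((z ^ (p ^ e) ^ m : Kˣ) : K), Finset.mem_filter.2 ⟨?_, by rw [hxz, hmin]⟩, hxz⟩
      rw [mem_primitiveRoots hd, IsPrimitiveRoot.coe_units_iff]
      have hzd : IsPrimitiveRoot z d := hz ▸ IsPrimitiveRoot.orderOf z
      exact hzd.pow_of_coprime _ (((Nat.Coprime.coprime_mul_left_right hpj).pow_left e).pow_left m)
    · rintro ⟨ζ, hζ, rfl⟩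
      rw [← (Finset.mem_filter.1 hζ).2]
      exact minpoly.aeval F _
  rw [(IsAlgClosed.splits (f.map (algebraMap F K))).eq_prod_roots_of_monic (hmonic.map _)]
  change ((f.aroots K).map fun x => X - C x).prod = _
  rw [← Finset.prod_image (s := Finset.filter (fun ζ => minpoly F (algebraMap F K b * ζ) = f)
      (primitiveRoots d K)) (g := fun ζ => algebraMap F K b * ζ) (f := fun x => X - C x)
      fun x _ y _ h => mul_left_cancel₀ hb0 h, ← hroots, Finset.prod, Multiset.toFinset_val,
    hnodup.dedup]

omit [Fintype F] in
theorem neZero_natCast_algebraicClosure [CharP F p] {d : ℕ} (h : p.Coprime d) :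
    NeZero (d : AlgebraicClosure F) := by
  have : CharP (AlgebraicClosure F) p :=
    charP_of_injective_algebraMap (algebraMap F (AlgebraicClosure F)).injective p
  exact ⟨fun h0 => hp.out.one_lt.ne' (Nat.Coprime.eq_one_of_dvd h
    ((CharP.cast_eq_zero_iff (AlgebraicClosure F) p d).1 h0))⟩

theorem card_twistedFactors_mul (hq : Fintype.card F = p ^ e) {b : Fˣ} {d : ℕ} (hd : 0 < d)
    (hbd : (orderOf b).Coprime d) (hpj : p.Coprime (orderOf b * d)) :
    (twistedFactors b d).card * ordMod (orderOf b * d) (p ^ e) = d.totient := by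
  have : CharP F p := charP_of_card_eq_prime_pow hq
  have hmonic : ∀ f ∈ twistedFactors b d, f.Monic := by
    intro f hf
    obtain ⟨z, -, rfl⟩ := (mem_twistedFactors hd).1 hf
    exact minpoly.monic (Algebra.IsIntegral.isIntegral _)
  have hdeg : ∀ f ∈ twistedFactors b d, f.natDegree = ordMod (orderOf b * d) (p ^ e) := by
    intro f hf
    obtain ⟨z, rfl, rfl⟩ := (mem_twistedFactors hd).1 hf
    rw [natDegree_minpoly_unit hq (by rwa [orderOf_twist hbd]), orderOf_twist hbd]
  have h := congrArg natDegree (prod_map_twistedFactors hq hd hbd hpj)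
  have : NeZero d := ⟨hd.ne'⟩
  have := neZero_natCast_algebraicClosure (F := F) (Nat.Coprime.coprime_mul_left_right hpj)
  obtain ⟨ζ, hζ⟩ := HasEnoughRootsOfUnity.exists_primitiveRoot (AlgebraicClosure F) d
  rw [natDegree_map, natDegree_prod_of_monic _ _ hmonic, Finset.sum_congr rfl hdeg,
    Finset.sum_const, smul_eq_mul, natDegree_prod_of_monic _ _ fun _ _ => monic_X_sub_C _] at h
  simp only [natDegree_X_sub_C, Finset.sum_const, smul_eq_mul, mul_one,
    hζ.card_primitiveRoots] at h
  exact h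

theorem prod_twistedFactors (hq : Fintype.card F = p ^ e) {b : Fˣ} {n' : ℕ} (hn' : 0 < n')
    (hbn : (orderOf b).Coprime n') (hpn : p.Coprime n') (hpb : p.Coprime (orderOf b)) :
    X ^ n' - C ((b : F) ^ n') = ∏ d ∈ n'.divisors, ∏ f ∈ twistedFactors b d, f := by
  classical
  have : CharP F p := charP_of_card_eq_prime_pow hq
  apply map_injective (algebraMap F (AlgebraicClosure F)) (algebraMap F _).injective
  have : NeZero n' := ⟨hn'.ne'⟩
  have := neZero_natCast_algebraicClosure (F := F) hpn
  obtain ⟨ζ, hζ⟩ := HasEnoughRootsOfUnity.exists_primitiveRoot (AlgebraicClosure F) n'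
  rw [Polynomial.map_prod, Finset.prod_congr rfl fun d hd => prod_map_twistedFactors hq
    (Nat.pos_of_mem_divisors hd) (hbn.coprime_dvd_right (Nat.dvd_of_mem_divisors hd))
    (Nat.Coprime.mul_right hpb (hpn.coprime_dvd_right (Nat.dvd_of_mem_divisors hd)))]
  have hmap : (X ^ n' - C ((b : F) ^ n') : F[X]).map (algebraMap F (AlgebraicClosure F)) =
      X ^ n' - C ((algebraMap F (AlgebraicClosure F) b) ^ n') := by simp
  rw [hmap, X_pow_sub_C_eq_prod hζ hn' rfl, ← Finset.prod_biUnion,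
    ← IsPrimitiveRoot.nthRoots_one_eq_biUnion_primitiveRoots]
  · refine Finset.prod_nbij (ζ ^ ·) (fun i _ => ?_) ?_ (fun ξ hξ => ?_) fun i _ => by rw [mul_comm]
    · rw [mem_nthRootsFinset hn', ← pow_mul, mul_comm, pow_mul, hζ.pow_eq_one, one_pow]
    · simpa using hζ.injOn_pow
    · obtain ⟨i, hi, h⟩ := hζ.eq_pow_of_pow_eq_one ((mem_nthRootsFinset hn' 1).1 hξ)
      exact ⟨i, by simpa using hi, h⟩
  · exact fun i _ j _ hij => IsPrimitiveRoot.disjoint hij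

theorem monic_irreducible_dvd_of_mem_twistedFactors {b : Fˣ} {d : ℕ} (hd : 0 < d)
    (hb : (orderOf b).Coprime d) {f : F[X]} (hf : f ∈ twistedFactors b d) :
    f.Monic ∧ Irreducible f ∧ f ∣ cyclotomic (orderOf b * d) F := by
  obtain ⟨z, rfl, rfl⟩ := (mem_twistedFactors hd).1 hf
  refine ⟨minpoly.monic (Algebra.IsIntegral.isIntegral _),
    minpoly.irreducible (Algebra.IsIntegral.isIntegral _), ?_⟩
  rw [← orderOf_twist hb]
  exact minpoly_dvd_cyclotomic (by rw [orderOf_twist hb]; exact Nat.mul_pos (orderOf_pos b) hd)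

/-- The condition `orderOf b ∣ 1 + p ^ (e - k)` says `b^{-p^{e-k}} = b`, so `#` moves only the root
of unity and preserves its order. -/
theorem hash_mem_twistedFactors (hq : Fintype.card F = p ^ e) {b : Fˣ} {d : ℕ} (hd : 0 < d)
    (hbd : (orderOf b).Coprime d) (hpj : p.Coprime (orderOf b * d))
    (hb : orderOf b ∣ 1 + p ^ (e - k)) {f : F[X]} (hf : f ∈ twistedFactors b d) :
    hash p e k f ∈ twistedFactors b d := by
  have : CharP F p := charP_of_card_eq_prime_pow hq
  obtain ⟨z, rfl, rfl⟩ := (mem_twistedFactors hd).1 hf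
  rw [mem_twistedFactors hd, hash_minpoly hq (by rwa [orderOf_twist hbd])]
  refine ⟨(z ^ p ^ (e - k))⁻¹, ?_, ?_⟩
  · rw [orderOf_inv, Nat.Coprime.orderOf_pow
      ((Nat.Coprime.coprime_mul_left_right hpj).symm.pow_right _)]
  · have h1 : (b ^ p ^ (e - k))⁻¹ = b := by
      rw [inv_eq_iff_mul_eq_one, ← pow_succ, add_comm]
      exact orderOf_dvd_iff_pow_eq_one.1 hb
    rw [mul_pow, mul_inv, ← map_pow, ← map_inv, h1]

/-- If `r` is coprime to `n'r/j`, then `r` divides `j`. These `j` are thus exactly the orders `rd`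
of the roots `bζ`. -/
theorem setA_eq_image {q n' r : ℕ} (hn' : 0 < n') (hr : 0 < r) (hrn : r.Coprime n')
    (hqn : q.Coprime n') (hqr : q.Coprime r) : setA q n' r = n'.divisors.image (r * ·) := by
  ext j
  simp only [setA, Finset.mem_filter, Nat.mem_divisors, Finset.mem_image]
  constructor
  · rintro ⟨⟨⟨c, hc⟩, h0⟩, -, h2⟩
    have hj : 0 < j := Nat.pos_of_ne_zero fun h => by simp [h] at hc; omega
    rw [hc, Nat.mul_div_cancel_left _ hj] at h2
    have hrj : r ∣ j := (h2.symm.dvd_of_dvd_mul_right (hc ▸ dvd_mul_left r n'))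
    obtain ⟨d, rfl⟩ := hrj
    exact ⟨d, ⟨⟨c, by nlinarith [Nat.eq_of_mul_eq_mul_left hr (by linarith : r * n' = r * (d * c))]⟩,
      hn'.ne'⟩, rfl⟩
  · rintro ⟨d, ⟨⟨c, rfl⟩, -⟩, rfl⟩
    have hd : 0 < d := Nat.pos_of_mul_pos_right hn'
    refine ⟨⟨⟨c, by ring⟩, by positivity⟩, ?_, ?_⟩
    · exact (Nat.Coprime.mul_right hqr (Nat.Coprime.coprime_mul_right_right hqn)).symm
    · have : d * c * r / (r * d) = c := by
        rw [show d * c * r = r * d * c by ring, Nat.mul_div_cancel_left _ (by positivity)]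
      rw [this]
      exact (Nat.Coprime.coprime_mul_left_right hrn).symm


theorem ordMod_pos {j : ℕ} (hj : p.Coprime j) : 0 < ordMod j (p ^ e) := by
  have : NeZero j := ⟨fun h => by
    rw [h, Nat.coprime_zero_right] at hj; exact hp.out.one_lt.ne' hj⟩
  rw [ordMod, ← ZMod.coe_unitOfCoprime (p ^ e) (hj.pow_left e), orderOf_units]
  exact orderOf_pos _

/-- The factors of order `j = r d` are the disjoint union of `β_a(j)` orbits of length `a`. -/
theorem exists_representatives (hq : Fintype.card F = p ^ e) (hk : k < e) {b : Fˣ} {d : ℕ}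
    (hd : 0 < d) (hbd : (orderOf b).Coprime d) (hpj : p.Coprime (orderOf b * d))
    (hb : orderOf b ∣ 1 + p ^ (e - k)) :
    ∃ a₀ ∈ (hashPeriod e k).divisors, (∀ a, orderOf b * d ∈ setB p e k a ↔ a = a₀) ∧
    ∃ r : ℕ → F[X],
      (∀ i < betaCount (p ^ e) (orderOf b) a₀ (orderOf b * d), r i ∈ twistedFactors b d) ∧
      ∏ i ∈ Finset.range (betaCount (p ^ e) (orderOf b) a₀ (orderOf b * d)),
        ∏ δ ∈ Finset.range a₀, (hash p e k)^[δ] (r i) = ∏ f ∈ twistedFactors b d, f := by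
  have : CharP F p := charP_of_card_eq_prime_pow hq
  classical
  have : NeZero d := ⟨hd.ne'⟩
  have := neZero_natCast_algebraicClosure (F := F) (Nat.Coprime.coprime_mul_left_right hpj)
  obtain ⟨ζ, hζ⟩ := HasEnoughRootsOfUnity.exists_primitiveRoot (AlgebraicClosure F) d
  have hf₀ : minpoly F (algebraMap F (AlgebraicClosure F) b * ζ) ∈ twistedFactors b d :=
    Finset.mem_image_of_mem _ ((mem_primitiveRoots hd).2 hζ)
  have hall : ∀ f ∈ twistedFactors b d, ∀ a, orderOf b * d ∈ setB p e k a ↔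
      a = Function.minimalPeriod (hash p e k) f := by
    intro f hf a
    obtain ⟨z, rfl, rfl⟩ := (mem_twistedFactors hd).1 hf
    rw [← mem_setB_iff_eq_minimalPeriod hq hk (by rwa [orderOf_twist hbd]), orderOf_twist hbd]
  set a₀ := Function.minimalPeriod (hash p e k)
    (minpoly F (algebraMap F (AlgebraicClosure F) b * ζ)) with ha₀
  have hdiv : a₀ ∈ (hashPeriod e k).divisors := by
    obtain ⟨z, hz, hfz⟩ := (mem_twistedFactors hd).1 hf₀
    rw [ha₀, hfz]
    subst hz
    exact minimalPeriod_mem_divisors hq hk (by rwa [orderOf_twist hbd])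
  have hpos : 0 < a₀ := Nat.pos_of_mem_divisors hdiv
  obtain ⟨⟨c, hc⟩, r, hr, hprod⟩ := exists_orbit_representatives (hash p e k) hpos (fun f => f)
    (twistedFactors b d) (fun f hf => hash_mem_twistedFactors hq hd hbd hpj hb hf)
    (fun f hf => ((hall f hf a₀).1 ((hall _ hf₀ a₀).2 rfl)).symm)
  -- There are `φ(d) / ord_j(q)` factors and `φ(j) = φ(r) φ(d)`, so the division in `betaCount` is
  -- exact.
  have hβ : betaCount (p ^ e) (orderOf b) a₀ (orderOf b * d) = (twistedFactors b d).card / a₀ := by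
    have h1 := card_twistedFactors_mul hq hd hbd hpj
    have h2 : 0 < (orderOf b).totient := Nat.totient_pos.2 (orderOf_pos b)
    have h3 := ordMod_pos (e := e) hpj
    rw [betaCount, Nat.totient_mul hbd, ← h1, hc, Nat.mul_div_cancel_left _ hpos]
    exact Nat.div_eq_of_eq_mul_left (by positivity) (by ring)
  exact ⟨a₀, hdiv, hall _ hf₀, r, by rwa [hβ], by rw [hβ]; exact hprod⟩

omit [Fintype F] in
-- Raising to the `m`-th power permutes the cyclic group generated by `lam`, so the root can be
-- taken there.
theorem exists_unit_pow_eq {lam : F} (h0 : lam ≠ 0) {m : ℕ} (h : (orderOf lam).Coprime m) :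
    ∃ b : Fˣ, orderOf b = orderOf lam ∧ (b : F) ^ m = lam := by
  have h1 : orderOf (Units.mk0 lam h0) = orderOf lam := by rw [← orderOf_units, Units.val_mk0]
  obtain ⟨v, hv⟩ := exists_pow_eq_self_of_coprime (x := Units.mk0 lam h0) (by rw [h1]; exact h.symm)
  refine ⟨Units.mk0 lam h0 ^ v, ?_, ?_⟩
  · rw [← h1]
    refine dvd_antisymm (orderOf_pow_dvd v) ?_
    conv_lhs => rw [← hv, ← pow_mul, mul_comm, pow_mul]
    exact orderOf_pow_dvd m
  · rw [← Units.val_pow_eq_pow_val, ← pow_mul, mul_comm, pow_mul, hv, Units.val_mk0]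

theorem coprime_of_dvd_one_add_pow (hk : k < e) {r : ℕ} (h : r ∣ 1 + p ^ (e - k)) :
    p.Coprime r := by
  refine Nat.Coprime.coprime_dvd_right h ((Nat.Prime.coprime_iff_not_dvd hp.out).2 fun h1 => ?_)
  have := (Nat.dvd_add_left (dvd_pow_self p (by omega : e - k ≠ 0))).1 h1
  exact hp.out.one_lt.ne' (Nat.dvd_one.1 this)

theorem exists_isHashFactorization (hq : Fintype.card F = p ^ e) (hk : k < e) {n' e' : ℕ}
    (hn' : 0 < n') (hpn : p.Coprime n') {lam : F} (h0 : lam ≠ 0)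
    (hln : (orderOf lam).Coprime n') (hl : orderOf lam ∣ 1 + p ^ (e - k)) :
    ∃ f : ℕ → ℕ → F[X], IsHashFactorization p e k n' e' lam f := by
  classical
  have : CharP F p := charP_of_card_eq_prime_pow hq
  have hpr := coprime_of_dvd_one_add_pow hk hl
  obtain ⟨b, hb, hbl⟩ := exists_unit_pow_eq h0 (m := n' * p ^ e')
    (Nat.Coprime.mul_right hln (hpr.symm.pow_right e'))
  set r := orderOf lam with hr
  have hrpos : 0 < r := hb ▸ orderOf_pos b
  have hA : setA (p ^ e) n' r = n'.divisors.image (r * ·) :=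
    setA_eq_image hn' hrpos hln (hpn.pow_left e) (hpr.pow_left e)
  have hrep : ∀ d ∈ n'.divisors, ∃ a₀ ∈ (hashPeriod e k).divisors,
      (∀ a, r * d ∈ setB p e k a ↔ a = a₀) ∧ ∃ f : ℕ → F[X],
      (∀ i < betaCount (p ^ e) r a₀ (r * d), f i ∈ twistedFactors b d) ∧
      ∏ i ∈ Finset.range (betaCount (p ^ e) r a₀ (r * d)),
        ∏ δ ∈ Finset.range a₀, (hash p e k)^[δ] (f i) = ∏ f ∈ twistedFactors b d, f := by
    intro d hd
    have hdn := Nat.dvd_of_mem_divisors hd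
    have := exists_representatives (b := b) hq hk (Nat.pos_of_mem_divisors hd)
      (by rw [hb]; exact hln.coprime_dvd_right hdn)
      (by rw [hb]; exact Nat.Coprime.mul_right hpr (hpn.coprime_dvd_right hdn)) (by rwa [hb])
    rwa [hb] at this
  choose! a₀ ha₀ haB f hf hprod using hrep
  refine ⟨fun j => f (j / r), ?_, ?_⟩
  · intro a _ j hj i hi
    obtain ⟨hjA, hjB⟩ := Finset.mem_filter.1 hj
    rw [hA] at hjA
    obtain ⟨d, hd, rfl⟩ := Finset.mem_image.1 hjA
    obtain rfl := (haB d hd a).1 hjB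
    dsimp only
    rw [Nat.mul_div_cancel_left _ hrpos]
    have := monic_irreducible_dvd_of_mem_twistedFactors (Nat.pos_of_mem_divisors hd)
      (by rw [hb]; exact hln.coprime_dvd_right (Nat.dvd_of_mem_divisors hd)) (hf d hd i hi)
    rwa [hb] at this
  · have hfac := prod_twistedFactors hq (b := b) hn' (by rwa [hb]) hpn (by rwa [hb])
    have hpow : X ^ (n' * p ^ e') - C lam = (X ^ n' - C ((b : F) ^ n')) ^ p ^ e' := by
      rw [sub_pow_char_pow, ← pow_mul, ← C_pow, ← pow_mul, hbl]
    rw [hpow, hfac, hashProd]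
    simp only [Finset.prod_pow]
    congr 1
    -- Each `j = rd` lies in `B_a` for the single value `a₀ d`, so the double product over `a` and
    -- `j` collapses to one over `d`.
    have hinner : ∀ a ∈ (hashPeriod e k).divisors,
        ∏ j ∈ setD p e k n' r a, ∏ i ∈ Finset.range (betaCount (p ^ e) r a j),
          ∏ δ ∈ Finset.range a, (hash p e k)^[δ] (f (j / r) i) =
        ∏ d ∈ n'.divisors, if a = a₀ d then ∏ f ∈ twistedFactors b d, f else 1 := by
      intro a _
      rw [setD, hA, Finset.prod_filter, Finset.prod_image fun x _ y _ h =>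
        Nat.eq_of_mul_eq_mul_left hrpos h]
      refine Finset.prod_congr rfl fun d hd => ?_
      rw [haB d hd a]
      split_ifs with h
      · subst h
        rw [Nat.mul_div_cancel_left _ hrpos, hprod d hd]
      · rfl
    rw [Finset.prod_congr rfl hinner, Finset.prod_comm]
    refine Finset.prod_congr rfl fun d hd => ?_
    rw [Finset.prod_ite_eq' (hashPeriod e k).divisors (a₀ d), if_pos (ha₀ d hd)]

end Factorization

/-! ### Cyclic sums and the bounds on `b` -/

section Cyclic

theorem prod_range_shift {M : Type*} [CommMonoid M] (c : ℕ → M) {a : ℕ} (ha : 0 < a)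
    (h : c a = c 0) : ∏ δ ∈ Finset.range a, c (δ + 1) = ∏ δ ∈ Finset.range a, c δ := by
  obtain ⟨b, rfl⟩ := Nat.exists_eq_succ_of_ne_zero ha.ne'
  rw [Finset.prod_range_succ, Finset.prod_range_succ', h]

theorem sum_range_shift {M : Type*} [AddCommMonoid M] (c : ℕ → M) {a : ℕ} (ha : 0 < a)
    (h : c a = c 0) : ∑ δ ∈ Finset.range a, c (δ + 1) = ∑ δ ∈ Finset.range a, c δ := by
  obtain ⟨b, rfl⟩ := Nat.exists_eq_succ_of_ne_zero ha.ne'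
  rw [Finset.sum_range_succ, Finset.sum_range_succ', h]

theorem sum_range_succ_mod (u : ℕ → ℤ) {a : ℕ} (ha : 0 < a) :
    ∑ δ ∈ Finset.range a, u ((δ + 1) % a) = ∑ δ ∈ Finset.range a, u δ := by
  rw [sum_range_shift (fun δ => u (δ % a)) ha (by simp)]
  exact Finset.sum_congr rfl fun δ hδ => by rw [Nat.mod_eq_of_lt (Finset.mem_range.1 hδ)]

/-- The lcm computation produces the index `δ + 1` in place of `δ - 1`. After a cyclic shift, the
two maxima differ by `u_{δ+1} - u_δ`, which sums to zero around the cycle. -/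
theorem bTerm_eq_sum (P : ℕ) {a : ℕ} (ha : 0 < a) (u : ℕ → ℕ) :
    bTerm P a u = ∑ δ ∈ Finset.range a, ((P : ℤ) - max (u δ : ℤ) ((P : ℤ) - u ((δ + 1) % a))) := by
  have h1 : ∑ δ ∈ Finset.range a, max (u δ : ℤ) ((P : ℤ) - u ((δ + a - 1) % a)) =
      ∑ δ ∈ Finset.range a, max (u ((δ + 1) % a) : ℤ) ((P : ℤ) - u δ) := by
    have h2 := sum_range_shift
      (fun δ => max (u (δ % a) : ℤ) ((P : ℤ) - u ((δ + a - 1) % a))) ha (by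
        simp only [Nat.mod_self, Nat.zero_mod, Nat.zero_add]
        rw [show a + a - 1 = a - 1 + a by omega, Nat.add_mod_right])
    refine Eq.trans (Finset.sum_congr rfl fun δ hδ => ?_)
      (h2.symm.trans (Finset.sum_congr rfl fun δ hδ => ?_))
    · rw [Nat.mod_eq_of_lt (Finset.mem_range.1 hδ)]
    · rw [show δ + 1 + a - 1 = δ + a by omega, Nat.add_mod_right,
        Nat.mod_eq_of_lt (Finset.mem_range.1 hδ)]
  have h3 : ∀ δ, max (u ((δ + 1) % a) : ℤ) ((P : ℤ) - u δ) =
      (u ((δ + 1) % a) - u δ) + max (u δ : ℤ) ((P : ℤ) - u ((δ + 1) % a)) := by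
    intro δ
    rw [← max_add_add_left]
    congr 1 <;> ring
  rw [bTerm, h1, Finset.sum_congr rfl fun δ _ => h3 δ, Finset.sum_add_distrib,
    Finset.sum_sub_distrib, Finset.sum_sub_distrib, sum_range_succ_mod (fun δ => (u δ : ℤ)) ha]
  simp

theorem bTerm_nonneg {P a : ℕ} (ha : 0 < a) {u : ℕ → ℕ} (hu : ∀ δ, u δ ≤ P) :
    0 ≤ bTerm P a u := by
  rw [bTerm_eq_sum P ha]
  refine Finset.sum_nonneg fun δ _ => ?_
  have := hu δ
  rw [sub_nonneg]
  exact max_le (by exact_mod_cast this) (by omega)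

/-- A maximum is at least the average of its arguments; the terms in `u` then cancel around the
cycle. -/
theorem bTerm_le {P a : ℕ} (ha : 0 < a) (u : ℕ → ℕ) :
    bTerm P a u ≤ ((a * P / 2 : ℕ) : ℤ) := by
  have h1 : 2 * bTerm P a u ≤ ((a * P : ℕ) : ℤ) := by
    rw [bTerm_eq_sum P ha, Finset.mul_sum]
    have h2 : ∀ δ ∈ Finset.range a,
        2 * ((P : ℤ) - max (u δ : ℤ) ((P : ℤ) - u ((δ + 1) % a))) ≤
          P + (u ((δ + 1) % a) - u δ) := by
      intro δ _
      have h3 := le_max_left (u δ : ℤ) ((P : ℤ) - u ((δ + 1) % a))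
      have h4 := le_max_right (u δ : ℤ) ((P : ℤ) - u ((δ + 1) % a))
      linarith
    refine (Finset.sum_le_sum h2).trans (le_of_eq ?_)
    rw [Finset.sum_add_distrib, Finset.sum_sub_distrib,
      sum_range_succ_mod (fun δ => (u δ : ℤ)) ha]
    simp
  omega

theorem sum_bTerm_bounds {P a : ℕ} (ha : 0 < a) (N : ℕ) {u : ℕ → ℕ → ℕ} (hu : ∀ i δ, u i δ ≤ P) :
    0 ≤ ∑ i ∈ Finset.range N, bTerm P a (u i) ∧
      ∑ i ∈ Finset.range N, bTerm P a (u i) ≤ (N : ℤ) * ((a * P / 2 : ℕ) : ℤ) := by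
  refine ⟨Finset.sum_nonneg fun i _ => bTerm_nonneg ha (hu i), ?_⟩
  simpa using Finset.sum_le_card_nsmul (Finset.range N) (fun i => bTerm P a (u i)) _
    fun i _ => bTerm_le ha (u i)

end Cyclic

/-- A divisor of a product of prime powers is associated to a product of smaller powers. -/
theorem exists_associated_prod_pow {M ι : Type*} [CommMonoidWithZero M] [IsCancelMulZero M]
    [DecompositionMonoid M] (s : Finset ι) (π : ι → M) (hπ : ∀ x ∈ s, Prime (π x)) (P : ℕ) (g : M)
    (hg : g ∣ ∏ x ∈ s, π x ^ P) :
    ∃ u : ι → ℕ, (∀ x, u x ≤ P) ∧ Associated g (∏ x ∈ s, π x ^ u x) := by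
  classical
  induction s using Finset.induction_on generalizing g with
  | empty =>
    exact ⟨fun _ => 0, fun _ => Nat.zero_le _, by
      simpa using (associated_one_iff_isUnit.2 (isUnit_of_dvd_one (by simpa using hg)))⟩
  | insert x s hx ih =>
    rw [Finset.prod_insert hx] at hg
    obtain ⟨g₁, g₂, h1, h2, rfl⟩ := exists_dvd_and_dvd_of_dvd_mul hg
    obtain ⟨i, hi, h3⟩ := (dvd_prime_pow (hπ x (Finset.mem_insert_self _ _)) P).1 h1
    obtain ⟨u, hu, h4⟩ := ih (fun y hy => hπ y (Finset.mem_insert_of_mem hy)) g₂ h2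
    refine ⟨Function.update u x i, fun y => ?_, ?_⟩
    · by_cases h : y = x
      · subst h; simpa using hi
      · simpa [h] using hu y
    · rw [Finset.prod_insert hx, Function.update_self]
      refine h3.mul_mul (h4.trans (Associated.of_eq (Finset.prod_congr rfl fun y hy => ?_)))
      rw [Function.update_of_ne (fun h : y = x => hx (h ▸ hy))]

/-! ### The hull of one component in terms of exponents -/

section Component

variable {F : Type*} [Field F] [Fintype F] {p e k : ℕ} [hp : Fact p.Prime]

theorem exists_unit_minpoly_eq (hq : Fintype.card F = p ^ e) {j : ℕ} (hj : p.Coprime j) {f : F[X]}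
    (hm : f.Monic) (hi : Irreducible f) (hd : f ∣ cyclotomic j F) :
    ∃ α : (AlgebraicClosure F)ˣ, orderOf α = j ∧ f = minpoly F (α : AlgebraicClosure F) := by
  have : CharP F p := charP_of_card_eq_prime_pow hq
  have hj0 : j ≠ 0 := fun h => by
    rw [h, Nat.coprime_zero_right] at hj; exact hp.out.one_lt.ne' hj
  have := neZero_natCast_algebraicClosure (F := F) hj
  obtain ⟨x, hx⟩ := IsAlgClosed.exists_aeval_eq_zero (AlgebraicClosure F) f
    (degree_pos_of_irreducible hi).ne'
  have hprim : IsPrimitiveRoot x j := by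
    rw [← isRoot_cyclotomic_iff, ← map_cyclotomic j (algebraMap F (AlgebraicClosure F)), IsRoot.def,
      eval_map_algebraMap]
    exact aeval_eq_zero_of_dvd_aeval_eq_zero hd hx
  obtain ⟨α, rfl⟩ := hprim.isUnit hj0
  exact ⟨α, (IsPrimitiveRoot.coe_units_iff.1 hprim).eq_orderOf.symm,
    minpoly.eq_of_irreducible_of_monic hi hx hm⟩

/-- The index set of the factors `f_{ij}^{δ#}`: tuples `(a, j, i, δ)`. -/
noncomputable def hashIndex (p e k n' r : ℕ) : Finset (Σ _ : ℕ, Σ _ : ℕ, Σ _ : ℕ, ℕ) :=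
  (hashPeriod e k).divisors.sigma fun a => (setD p e k n' r a).sigma fun j =>
    (Finset.range (betaCount (p ^ e) r a j)).sigma fun _ => Finset.range a

/-- The factor `f_{ij}^{δ#}` of index `(a, j, i, δ)`. -/
noncomputable def hashFactor (p e k : ℕ) (f : ℕ → ℕ → F[X]) (x : Σ _ : ℕ, Σ _ : ℕ, Σ _ : ℕ, ℕ) :
    F[X] :=
  (hash p e k)^[x.2.2.2] (f x.2.1 x.2.2.1)

omit [Fintype F] hp in
theorem hashProd_eq_prod (n' r : ℕ) (f : ℕ → ℕ → F[X]) (u : ℕ → ℕ → ℕ → ℕ → ℕ) :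
    hashProd p e k n' r f u = ∏ x ∈ hashIndex p e k n' r,
      hashFactor p e k f x ^ u x.1 x.2.1 x.2.2.1 x.2.2.2 := by
  simp only [hashIndex, Finset.prod_sigma, hashProd, hashFactor]

omit hp in
theorem sum_hashIndex {M : Type*} [AddCommMonoid M] (n' r : ℕ) (v : ℕ → ℕ → ℕ → ℕ → M) :
    ∑ x ∈ hashIndex p e k n' r, v x.1 x.2.1 x.2.2.1 x.2.2.2 =
      ∑ a ∈ (hashPeriod e k).divisors, ∑ j ∈ setD p e k n' r a,
        ∑ i ∈ Finset.range (betaCount (p ^ e) r a j), ∑ δ ∈ Finset.range a, v a j i δ := by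
  simp only [hashIndex, Finset.sum_sigma]

omit hp in
theorem mem_setD {n' r a j : ℕ} :
    j ∈ setD p e k n' r a ↔ j ∈ setA (p ^ e) n' r ∧ j ∈ setB p e k a := by
  classical
  exact Finset.mem_filter

omit hp in
theorem coprime_of_mem_setD (hk : k < e) {n' r a j : ℕ} (hj : j ∈ setD p e k n' r a) :
    p.Coprime j :=
  ((Nat.coprime_pow_right_iff (by omega) _ _).1 (Finset.mem_filter.1 (mem_setD.1 hj).1).2.1).symm

variable {n' e' : ℕ} {lam : F} {f : ℕ → ℕ → F[X]}

theorem hashFactor_spec (hq : Fintype.card F = p ^ e) (hk : k < e)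
    (hf : IsHashFactorization p e k n' e' lam f) {x : Σ _ : ℕ, Σ _ : ℕ, Σ _ : ℕ, ℕ}
    (hx : x ∈ hashIndex p e k n' (orderOf lam)) :
    (hashFactor p e k f x).Monic ∧ Irreducible (hashFactor p e k f x) ∧
      (hashFactor p e k f x).coeff 0 ≠ 0 ∧
      (hashFactor p e k f x).natDegree = ordMod x.2.1 (p ^ e) ∧
      (hash p e k)^[x.1] (f x.2.1 x.2.2.1) = f x.2.1 x.2.2.1 := by
  have : CharP F p := charP_of_card_eq_prime_pow hq
  obtain ⟨a, j, i, δ⟩ := x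
  simp only [hashIndex, Finset.mem_sigma, Finset.mem_range] at hx
  obtain ⟨ha, hj, hi, hδ⟩ := hx
  have hpj := coprime_of_mem_setD hk hj
  obtain ⟨h1, h2, h3⟩ := hf.1 a ha j hj i hi
  obtain ⟨α, rfl, hα⟩ := exists_unit_minpoly_eq hq hpj h1 h2 h3
  have hint : ∀ β : (AlgebraicClosure F)ˣ, IsIntegral F (β : AlgebraicClosure F) :=
    fun β => Algebra.IsIntegral.isIntegral _
  have heq : hashFactor p e k f ⟨a, orderOf α, i, δ⟩ = minpoly F
      ((α ^ (-(p : ℤ) ^ (e - k)) ^ δ : (AlgebraicClosure F)ˣ) : AlgebraicClosure F) := by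
    rw [← hash_iterate_minpoly hq hpj, ← hα]
    rfl
  rw [heq]
  refine ⟨minpoly.monic (hint _), minpoly.irreducible (hint _),
    minpoly.coeff_zero_ne_zero (hint _) (Units.ne_zero _), ?_, ?_⟩
  · rw [natDegree_minpoly_unit hq (by rwa [orderOf_zpow_neg_prime_pow hpj]),
      orderOf_zpow_neg_prime_pow hpj]
  · rw [hα]
    exact ((mem_setB_iff_isLeast hq hpj a).1 (mem_setD.1 hj).2).1.2

/-- The given factorization is arbitrary, so distinctness of its factors must be derived. Uniqueness
of `p^{e'}`-th roots identifies their product with `x^{n'} - b^{n'}`, which is separable. -/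
theorem isCoprime_hashFactor (hq : Fintype.card F = p ^ e) (hk : k < e) (hpn : p.Coprime n')
    (h0 : lam ≠ 0) (hln : (orderOf lam).Coprime n') (hl : orderOf lam ∣ 1 + p ^ (e - k))
    (hf : IsHashFactorization p e k n' e' lam f) :
    (hashIndex p e k n' (orderOf lam) : Set _).Pairwise
      (Function.onFun IsCoprime (hashFactor p e k f)) := by
  classical
  have : CharP F p := charP_of_card_eq_prime_pow hq
  obtain ⟨b, -, hbl⟩ := exists_unit_pow_eq h0 (m := n' * p ^ e')
    (Nat.Coprime.mul_right hln ((coprime_of_dvd_one_add_pow hk hl).symm.pow_right e'))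
  have hprod : ∏ x ∈ hashIndex p e k n' (orderOf lam), hashFactor p e k f x =
      X ^ n' - C ((b : F) ^ n') := by
    have h1 := hf.2
    rw [hashProd_eq_prod, Finset.prod_pow] at h1
    have hpow : X ^ (n' * p ^ e') - C lam = (X ^ n' - C ((b : F) ^ n')) ^ p ^ e' := by
      rw [sub_pow_char_pow, ← pow_mul, ← C_pow, ← pow_mul, hbl]
    rw [hpow] at h1
    rw [← sub_eq_zero]
    refine eq_zero_of_pow_eq_zero (n := p ^ e') ?_
    rw [sub_pow_char_pow, ← h1, sub_self]
  have hsep : (∏ x ∈ hashIndex p e k n' (orderOf lam), hashFactor p e k f x).Separable := by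
    rw [hprod]
    refine separable_X_pow_sub_C' p n' _ (fun h => ?_) (pow_ne_zero _ b.ne_zero)
    exact hp.out.one_lt.ne' (Nat.Coprime.eq_one_of_dvd hpn h)
  intro x hx y hy hxy
  rw [← Finset.mul_prod_erase _ _ (Finset.mem_coe.1 hx),
    ← Finset.mul_prod_erase _ _ (Finset.mem_erase.2 ⟨hxy.symm, hy⟩), ← mul_assoc] at hsep
  exact hsep.of_mul_left.isCoprime

theorem prod_hashFactor_dvd_iff (hq : Fintype.card F = p ^ e) (hk : k < e) (hpn : p.Coprime n')
    (h0 : lam ≠ 0) (hln : (orderOf lam).Coprime n') (hl : orderOf lam ∣ 1 + p ^ (e - k))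
    (hf : IsHashFactorization p e k n' e' lam f) (u : ℕ → ℕ → ℕ → ℕ → ℕ) (w : F[X]) :
    hashProd p e k n' (orderOf lam) f u ∣ w ↔ ∀ x ∈ hashIndex p e k n' (orderOf lam),
      hashFactor p e k f x ^ u x.1 x.2.1 x.2.2.1 x.2.2.2 ∣ w := by
  rw [hashProd_eq_prod]
  refine ⟨fun h x hx => (Finset.dvd_prod_of_mem (fun x => hashFactor p e k f x ^
    u x.1 x.2.1 x.2.2.1 x.2.2.2) hx).trans h, fun h => Finset.prod_dvd_of_coprime ?_ h⟩
  exact fun x hx y hy hxy =>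
    (isCoprime_hashFactor hq hk hpn h0 hln hl hf hx hy hxy).pow

theorem natDegree_hashProd (hq : Fintype.card F = p ^ e) (hk : k < e)
    (hf : IsHashFactorization p e k n' e' lam f) (u : ℕ → ℕ → ℕ → ℕ → ℕ) :
    (hashProd p e k n' (orderOf lam) f u).Monic ∧
    (hashProd p e k n' (orderOf lam) f u).natDegree = ∑ x ∈ hashIndex p e k n' (orderOf lam),
      ordMod x.2.1 (p ^ e) * u x.1 x.2.1 x.2.2.1 x.2.2.2 := by
  have hmonic : ∀ x ∈ hashIndex p e k n' (orderOf lam),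
      (hashFactor p e k f x ^ u x.1 x.2.1 x.2.2.1 x.2.2.2).Monic :=
    fun x hx => (hashFactor_spec hq hk hf hx).1.pow _
  rw [hashProd_eq_prod]
  refine ⟨monic_prod_of_monic _ _ hmonic, ?_⟩
  rw [natDegree_prod_of_monic _ _ hmonic]
  refine Finset.sum_congr rfl fun x hx => ?_
  rw [natDegree_pow, (hashFactor_spec hq hk hf hx).2.2.2.1, mul_comm]

/-- `#` shifts the exponents of a product along the orbits. -/
theorem hash_hashProd (hq : Fintype.card F = p ^ e) (hk : k < e)
    (hf : IsHashFactorization p e k n' e' lam f) (u : ℕ → ℕ → ℕ → ℕ → ℕ) :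
    hash p e k (hashProd p e k n' (orderOf lam) f fun a j i δ => u a j i ((δ + 1) % a)) =
      hashProd p e k n' (orderOf lam) f u := by
  have : CharP F p := charP_of_card_eq_prime_pow hq
  rw [← hashHom_apply]
  simp only [hashProd, map_prod, map_pow, hashHom_apply, ← Function.iterate_succ_apply']
  refine Finset.prod_congr rfl fun a ha => Finset.prod_congr rfl fun j hj =>
    Finset.prod_congr rfl fun i hi => ?_
  have hpos : 0 < a := Nat.pos_of_mem_divisors ha
  have hper := (hashFactor_spec (x := ⟨a, j, i, 0⟩) hq hk hf (by
    simp only [hashIndex, Finset.mem_sigma, Finset.mem_range]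
    exact ⟨ha, hj, Finset.mem_range.1 hi, hpos⟩)).2.2.2.2
  -- The orbit closes up after `a` steps, so the factor with `δ = a` equals the one with `δ = 0`.
  rw [prod_range_shift (fun δ => (hash p e k)^[δ] (f j i) ^ u a j i (δ % a)) hpos
    (by simp only [Nat.mod_self, Nat.zero_mod]; rw [hper]; rfl)]
  exact Finset.prod_congr rfl fun δ hδ => by rw [Nat.mod_eq_of_lt (Finset.mem_range.1 hδ)]

theorem exists_eq_hashProd (hq : Fintype.card F = p ^ e) (hk : k < e)
    (hf : IsHashFactorization p e k n' e' lam f) {g : F[X]} (hg : g.Monic)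
    (hgd : g ∣ X ^ (n' * p ^ e') - C lam) :
    ∃ u : ℕ → ℕ → ℕ → ℕ → ℕ, (∀ a j i δ, u a j i δ ≤ p ^ e') ∧
      g = hashProd p e k n' (orderOf lam) f u := by
  rw [hf.2, hashProd_eq_prod] at hgd
  obtain ⟨u, hu, hgu⟩ := exists_associated_prod_pow _ _
    (fun x hx => (hashFactor_spec hq hk hf hx).2.1.prime) _ g hgd
  refine ⟨fun a j i δ => u ⟨a, j, i, δ⟩, fun a j i δ => hu _, ?_⟩
  refine eq_of_monic_of_associated hg (natDegree_hashProd hq hk hf _).1 ?_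
  rwa [hashProd_eq_prod]

theorem finrank_galoisHull_of_generator (hq : Fintype.card F = p ^ e) (hk : k < e) (hn' : 0 < n')
    (hpn : p.Coprime n') (h0 : lam ≠ 0) (hln : (orderOf lam).Coprime n')
    (hl : orderOf lam ∣ 1 + p ^ (e - k)) (hf : IsHashFactorization p e k n' e' lam f)
    {u : ℕ → ℕ → ℕ → ℕ → ℕ} (hu : ∀ a j i δ, u a j i δ ≤ p ^ e')
    (D : Submodule F (Fin (n' * p ^ e') → F))
    (hD : ∀ c, c ∈ D ↔ hashProd p e k n' (orderOf lam) f u ∣ wordPoly c) :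
    (Module.finrank F (galoisHull p k D) : ℤ) =
      ∑ a ∈ (hashPeriod e k).divisors, ∑ j ∈ setD p e k n' (orderOf lam) a,
        (ordMod j (p ^ e) : ℤ) * ∑ i ∈ Finset.range (betaCount (p ^ e) (orderOf lam) a j),
          bTerm (p ^ e') a (u a j i) := by
  have : CharP F p := charP_of_card_eq_prime_pow hq
  -- The exponents of `G`: after the shift by `#`, they become the cofactor exponents `p^{e'} -
  -- u_δ`.
  set v : ℕ → ℕ → ℕ → ℕ → ℕ := fun a j i δ => p ^ e' - u a j i ((δ + 1) % a) with hv
  set m : ℕ → ℕ → ℕ → ℕ → ℕ := fun a j i δ => max (u a j i δ) (v a j i δ) with hm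
  have hn : 0 < n' * p ^ e' := Nat.mul_pos hn' (pow_pos hp.out.pos _)
  have hgh : hashProd p e k n' (orderOf lam) f u *
      hash p e k (hashProd p e k n' (orderOf lam) f v) = X ^ (n' * p ^ e') - C lam := by
    rw [hash_hashProd hq hk hf (fun a j i δ => p ^ e' - u a j i δ), hf.2]
    simp only [hashProd_eq_prod, ← Finset.prod_mul_distrib, ← pow_add]
    exact Finset.prod_congr rfl fun x _ => by rw [Nat.add_sub_cancel' (hu _ _ _ _)]
  have hG : (hashProd p e k n' (orderOf lam) f v).coeff 0 ≠ 0 := by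
    rw [coeff_zero_eq_eval_zero, hashProd_eq_prod, eval_prod, Finset.prod_ne_zero_iff]
    intro x hx
    rw [eval_pow, ← coeff_zero_eq_eval_zero]
    exact pow_ne_zero _ (hashFactor_spec hq hk hf hx).2.2.1
  -- The factors are pairwise coprime, so divisibility by both `g` and `G` is tested factor by
  -- factor with the larger exponent.
  have hL : ∀ c, c ∈ galoisHull p k D ↔
      hashProd p e k n' (orderOf lam) f m ∣ wordPoly c := by
    intro c
    rw [mem_galoisHull_iff hq hk.le hn hgh hG D hD]
    simp only [prod_hashFactor_dvd_iff hq hk hpn h0 hln hl hf, ← forall_and]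
    refine forall₂_congr fun x _ => ?_
    simp only [hm]
    rcases le_total (u x.1 x.2.1 x.2.2.1 x.2.2.2) (v x.1 x.2.1 x.2.2.1 x.2.2.2) with h | h
    · rw [max_eq_right h]
      exact ⟨fun h1 => h1.2, fun h1 => ⟨(pow_dvd_pow _ h).trans h1, h1⟩⟩
    · rw [max_eq_left h]
      exact ⟨fun h1 => h1.1, fun h1 => ⟨h1, (pow_dvd_pow _ h).trans h1⟩⟩
  obtain ⟨hLm, hLd⟩ := natDegree_hashProd hq hk hf m
  -- Writing `n` as the degree of the full factorization allows the subtraction of degrees term by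
  -- term.
  have hdeg : n' * p ^ e' = ∑ x ∈ hashIndex p e k n' (orderOf lam), ordMod x.2.1 (p ^ e) * p ^ e' := by
    have := (natDegree_hashProd hq hk hf fun _ _ _ _ => p ^ e').2
    rwa [← hf.2, natDegree_X_pow_sub_C] at this
  have hle : (hashProd p e k n' (orderOf lam) f m).natDegree ≤ n' * p ^ e' := by
    rw [hLd, hdeg]
    exact Finset.sum_le_sum fun x _ =>
      Nat.mul_le_mul_left _ (max_le (hu _ _ _ _) (Nat.sub_le _ _))
  rw [finrank_eq_sub_natDegree hLm hle _ hL, Nat.cast_sub hle, hLd]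
  conv_lhs => rw [hdeg]
  rw [Nat.cast_sum, Nat.cast_sum, ← Finset.sum_sub_distrib]
  simp only [Nat.cast_mul, ← mul_sub]
  rw [sum_hashIndex n' (orderOf lam)
    (fun a j i δ => (ordMod j (p ^ e) : ℤ) * (((p ^ e' : ℕ) : ℤ) - (m a j i δ : ℤ)))]
  refine Finset.sum_congr rfl fun a ha => Finset.sum_congr rfl fun j _ => ?_
  rw [Finset.mul_sum]
  refine Finset.sum_congr rfl fun i _ => ?_
  rw [bTerm_eq_sum _ (Nat.pos_of_mem_divisors ha), Finset.mul_sum]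
  refine Finset.sum_congr rfl fun δ _ => ?_
  rw [hm, hv]
  dsimp only
  rw [Nat.cast_max, Nat.cast_sub (hu _ _ _ _)]

end Component

end GaloisHull

/-! ### Assembly over the classes -/

open GaloisHull
theorem theorem13 {F : Type*} [Field F] [Fintype F] {p e k n n' e' l : ℕ}
    (hp : p.Prime) (hq : Fintype.card F = p ^ e) (hk : k < e)
    (hn : 0 < n) (hnn : n = n' * p ^ e') (hn' : Nat.gcd n' p = 1)
    (t : Fin l → Polynomial F) (ht : ∀ i, Squarefree (t i)) (hsplit : ∀ i, (t i).Splits)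
    (lam : (Alphabet t)ˣ) (hgcd : Nat.gcd (orderOf lam) n' = 1)
    (hord : orderOf lam ∣ 1 + p ^ (e - k)) :
    -- `lam = ∑ lam_S e_S` with `lam_S` in `F`
    ∃ lamS : classes t → F, (lam : Alphabet t) = ∑ S, lamS S • classIdem t S ∧
    -- every `x^n - lam_S` has a `#`-orbit factorization
    (∀ S, ∃ f : ℕ → ℕ → Polynomial F, IsHashFactorization p e k n' e' (lamS S) f) ∧
    -- for all such factorizations and all `lam`-constacyclic codes `C`
    ∀ f : classes t → ℕ → ℕ → Polynomial F,
      (∀ S, IsHashFactorization p e k n' e' (lamS S) (f S)) →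
    ∀ C : Submodule (Alphabet t) (Fin n → Alphabet t), IsConstacyclic (lam : Alphabet t) C →
    ∃ u : classes t → ℕ → ℕ → ℕ → ℕ → ℕ,
      -- the `u` are the exponents of the generator polynomials of the components `C_S`
      (∀ S a j i δ, u S a j i δ ≤ p ^ e') ∧
      (∀ S, IsGeneratorPoly (lamS S) (projCode t C S)
        (hashProd p e k n' (orderOf (lamS S)) (f S) (u S))) ∧
      -- the dimension of the hull
      (Module.finrank F (galoisHull p k C) : ℤ) =
        ∑ S, ∑ a ∈ (hashPeriod e k).divisors, ∑ j ∈ setD p e k n' (orderOf (lamS S)) a,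
          (ordMod j (p ^ e) : ℤ) *
            ∑ i ∈ Finset.range (betaCount (p ^ e) (orderOf (lamS S)) a j),
              bTerm (p ^ e') a (u S a j i) ∧
      -- the bounds
      ∀ S, ∀ a ∈ (hashPeriod e k).divisors, ∀ j ∈ setD p e k n' (orderOf (lamS S)) a,
        0 ≤ ∑ i ∈ Finset.range (betaCount (p ^ e) (orderOf (lamS S)) a j),
              bTerm (p ^ e') a (u S a j i) ∧
        ∑ i ∈ Finset.range (betaCount (p ^ e) (orderOf (lamS S)) a j),
              bTerm (p ^ e') a (u S a j i) ≤
          (betaCount (p ^ e) (orderOf (lamS S)) a j : ℤ) * ((a * p ^ e' / 2 : ℕ) : ℤ) := by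
  subst hnn
  have : Fact p.Prime := ⟨hp⟩
  have hn'pos : 0 < n' := Nat.pos_of_mul_pos_right hn
  have hpn : p.Coprime n' := Nat.Coprime.symm hn'
  have h0 : ∀ S : classes t, classEval S (lam : Alphabet t) ≠ 0 := fun S =>
    (lam.isUnit.map (classEval S)).ne_zero
  -- Each coordinate of `lam` inherits both order hypotheses, since its order divides that of `lam`.
  have hdvd : ∀ S : classes t, orderOf (classEval S (lam : Alphabet t)) ∣ orderOf lam := fun S => by
    rw [← orderOf_units]
    exact orderOf_map_dvd (classEval S : Alphabet t →* F) _
  have hln : ∀ S : classes t, (orderOf (classEval S (lam : Alphabet t))).Coprime n' := fun S =>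
    Nat.Coprime.coprime_dvd_left (hdvd S) hgcd
  have hl : ∀ S : classes t, orderOf (classEval S (lam : Alphabet t)) ∣ 1 + p ^ (e - k) :=
    fun S => (hdvd S).trans hord
  refine ⟨fun S => classEval S lam, eq_sum_classEval ht hsplit _,
    fun S => exists_isHashFactorization hq hk hn'pos hpn (h0 S) (hln S) (hl S), ?_⟩
  intro f hf C hC
  have hgen : ∀ S : classes t, ∃ u : ℕ → ℕ → ℕ → ℕ → ℕ, (∀ a j i δ, u a j i δ ≤ p ^ e') ∧
      hashProd p e k n' (orderOf (classEval S (lam : Alphabet t))) (f S) u ∣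
        Polynomial.X ^ (n' * p ^ e') - Polynomial.C (classEval S (lam : Alphabet t)) ∧
      ∀ c, c ∈ componentCode C S ↔
        hashProd p e k n' (orderOf (classEval S (lam : Alphabet t))) (f S) u ∣ wordPoly c := by
    intro S
    obtain ⟨g, hgm, hgd, hgc⟩ := exists_monic_generator hn (classEval S : Alphabet t →+* F)
      (fun x => ⟨algebraMap F _ x, (classEval S).commutes x⟩) (lam : Alphabet t) C hC
    obtain ⟨u, hu, rfl⟩ := exists_eq_hashProd hq hk (hf S) hgm hgd
    exact ⟨u, hu, hgd, hgc⟩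
  choose u hu hgd hgc using hgen
  refine ⟨u, hu, fun S => ?_, ?_, fun S a ha j _ => ?_⟩
  · rw [projCode_eq ht hsplit, isGeneratorPoly_iff]
    exact ⟨(natDegree_hashProd hq hk (hf S) (u S)).1, hgd S, hgc S⟩
  · rw [finrank_galoisHull ht hsplit, Nat.cast_sum]
    exact Finset.sum_congr rfl fun S _ => finrank_galoisHull_of_generator hq hk hn'pos hpn (h0 S)
      (hln S) (hl S) (hf S) (hu S) _ (hgc S)
  · exact sum_bTerm_bounds (Nat.pos_of_mem_divisors ha) _ fun i δ => hu S a j i δ
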